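/- Let $x=(x_1,x_2,\dots)$ be countably many variables. For a partition $\lambda$ let $s_\lambda=s_\lambda(x)$ denote the Schur function and $\lambda'$ the conjugate partition, and for $r\geq 1$ let $p_r=\sum_{i\geq 1}x_i^r$ be the $r$-th power sum. A partition is called even if all of its parts are even. Let $$y=\sum_{\lambda,\ \lambda'\ \text{even}} s_\lambda(x),$$ where the sum runs over all partitions $\lambda$ such that both $\lambda$ and $\lambda'$ are even; it is a formal power series in $x_1,x_2,\dots$ with rational coefficients and constant term $1$. Then $$\log y-\sum_{n\geq 1}\frac{1}{4n}\,p_{2n}^2\ \in\ \mathbb{Q}[[p_1,p_3,p_5,\dots]],$$ that is, the formal power series on the left, where $\log y=\sum_{k\geq 1}\frac{(-1)^{k-1}}{k}(y-1)^k$, can be written as a formal power series with rational coefficients in the odd power sums $p_1,p_3,p_5,\dots$. -/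

import Mathlib

open scoped MvPowerSeries.WithPiTopology

namespace SymmFn

/-- All parts of the partition with Young diagram `μ` are even (row lengths beyond the last
part are `0`). -/
def IsEven (μ : YoungDiagram) : Prop :=
  ∀ i, Even (μ.rowLen i)

/-- The exponent vector of the monomial `x^T`: the entry `k` occurs `weight T k` times in `T`. -/
noncomputable def weight {μ : YoungDiagram} (T : SemistandardYoungTableau μ) : ℕ →₀ ℕ :=
  ∑ c ∈ μ.cells, Finsupp.single (T c.1 c.2) 1

/-- The Schur function `s_μ(x)` in the countably many variables `x_0, x_1, x_2, …`, that is
`∑_T x^T` over all semistandard Young tableaux `T` of shape `μ`, as a formal power series. -/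
noncomputable def schur (μ : YoungDiagram) : MvPowerSeries ℕ ℚ :=
  fun d => ({T : SemistandardYoungTableau μ | weight T = d}.ncard : ℚ)

/-- The power sum `p_r = ∑_i x_i^r`, as a formal power series in `x_0, x_1, x_2, …`. -/
noncomputable def powerSum (r : ℕ) : MvPowerSeries ℕ ℚ :=
  ∑' i : ℕ, (MvPowerSeries.X i) ^ r

/-- The sum `y` of the Schur functions `s_λ` over all partitions `λ` such that `λ` and its
conjugate `λ'` are both even. -/
noncomputable def evenSchurSum : MvPowerSeries ℕ ℚ :=
  ∑' μ : {μ : YoungDiagram // IsEven μ ∧ IsEven μ.transpose}, schur μ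

/-- `log f = ∑_{k ≥ 1} (-1)^(k-1) (f - 1)^k / k`, for `f` with constant term `1`. -/
noncomputable def formalLog (f : MvPowerSeries ℕ ℚ) : MvPowerSeries ℕ ℚ :=
  (PowerSeries.log ℚ).subst (f - 1)

/-! ### The infinite sums and substitutions above and below are meaningful -/

theorem degree_weight {μ : YoungDiagram} (T : SemistandardYoungTableau μ) :
    (weight T).degree = μ.card := by
  simp [weight, map_sum, YoungDiagram.card]

theorem finite_weight_eq (μ : YoungDiagram) (d : ℕ →₀ ℕ) :
    {T : SemistandardYoungTableau μ | weight T = d}.Finite := by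
  have key : ∀ T : SemistandardYoungTableau μ, weight T = d →
      ∀ c : μ.cells, T c.1.1 c.1.2 ∈ d.support := by
    rintro T rfl ⟨c, hc⟩
    rw [Finsupp.mem_support_iff, weight, Finsupp.finsetSum_apply]
    intro h
    have := (Finset.sum_eq_zero_iff.mp h) c hc
    simp at this
  refine Set.Finite.of_injOn
    (f := fun (T : SemistandardYoungTableau μ) (c : μ.cells) => T c.1.1 c.1.2)
    (t := {g | ∀ c, g c ∈ (d.support : Set ℕ)}) (fun T hT c => key T hT c) ?_ ?_
  · intro T _ T' _ h
    ext i j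
    by_cases hc : (i, j) ∈ μ
    · exact congrFun h ⟨(i, j), hc⟩
    · rw [T.zeros hc, T'.zeros hc]
  · exact Set.Finite.pi' fun _ => d.support.finite_toSet

theorem coeff_schur (μ : YoungDiagram) (d : ℕ →₀ ℕ) :
    MvPowerSeries.coeff d (schur μ)
      = ({T : SemistandardYoungTableau μ | weight T = d}.ncard : ℚ) :=
  rfl

theorem coeff_schur_eq_zero {μ : YoungDiagram} {d : ℕ →₀ ℕ} (h : d.degree ≠ μ.card) :
    MvPowerSeries.coeff d (schur μ) = 0 := by
  have : {T : SemistandardYoungTableau μ | weight T = d} = ∅ := by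
    ext T
    simp only [Set.mem_ofPred_eq, Set.mem_empty_iff_false, iff_false]
    rintro rfl
    exact h (degree_weight T)
  rw [coeff_schur, this]
  simp

theorem finite_card_eq (n : ℕ) : {μ : YoungDiagram | μ.card = n}.Finite := by
  refine Set.Finite.of_injOn (f := YoungDiagram.cells)
    (t := ((Finset.range n ×ˢ Finset.range n).powerset : Set (Finset (ℕ × ℕ)))) ?_ ?_
    (Finset.finite_toSet _)
  · rintro μ (rfl : μ.card = n)
    simp only [Finset.mem_coe, Finset.mem_powerset]
    rintro ⟨i, j⟩ hc
    have hsub : Finset.range (i + 1) ×ˢ Finset.range (j + 1) ⊆ μ.cells := by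
      rintro ⟨a, b⟩ hab
      simp only [Finset.mem_product, Finset.mem_range] at hab
      exact μ.up_left_mem (by omega) (by omega) hc
    have := Finset.card_le_card hsub
    simp only [Finset.card_product, Finset.card_range] at this
    simp only [Finset.mem_product, Finset.mem_range, YoungDiagram.card]
    constructor <;> nlinarith
  · intro μ _ ν _ h
    exact YoungDiagram.ext h

theorem summable_schur :
    Summable fun μ : {μ : YoungDiagram // IsEven μ ∧ IsEven μ.transpose} => schur μ := by
  rw [MvPowerSeries.WithPiTopology.summable_iff_summable_coeff]
  intro d
  refine summable_of_hasFiniteSupport ?_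
  refine ((finite_card_eq d.degree).preimage Subtype.val_injective.injOn).subset ?_
  intro μ hμ
  by_contra h
  exact hμ (coeff_schur_eq_zero fun e => h e.symm)

theorem constantCoeff_schur_bot : MvPowerSeries.constantCoeff (schur ⊥) = 1 := by
  rw [← MvPowerSeries.coeff_zero_eq_constantCoeff_apply, coeff_schur]
  have : {T : SemistandardYoungTableau ⊥ | weight T = 0}
      = {SemistandardYoungTableau.highestWeight ⊥} := by
    ext T
    simp only [Set.mem_ofPred_eq, Set.mem_singleton_iff]
    refine ⟨fun _ => ?_, fun _ => by simp [weight]⟩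
    ext i j
    rw [T.zeros (YoungDiagram.notMem_bot _),
      (SemistandardYoungTableau.highestWeight ⊥).zeros (YoungDiagram.notMem_bot _)]
  rw [this]
  simp

theorem isEven_bot : IsEven ⊥ := by
  intro i
  have : (⊥ : YoungDiagram).rowLen i = 0 := by
    rw [YoungDiagram.rowLen_eq_card]; rfl
  simp [this]

/-- `y` has constant term `1`, so that `log y` is meaningful. -/
theorem constantCoeff_evenSchurSum : MvPowerSeries.constantCoeff evenSchurSum = 1 := by
  have hs := summable_schur.hasSum
  rw [MvPowerSeries.WithPiTopology.hasSum_iff_hasSum_coeff] at hs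
  have h0 := hs 0
  have hb : IsEven ⊥ ∧ IsEven (⊥ : YoungDiagram).transpose := by
    refine ⟨isEven_bot, ?_⟩
    have : (⊥ : YoungDiagram).transpose = ⊥ := by
      ext c; simp
    rw [this]; exact isEven_bot
  have h1 := hasSum_single (f := fun μ : {μ : YoungDiagram // IsEven μ ∧ IsEven μ.transpose} =>
      MvPowerSeries.coeff 0 (schur μ)) ⟨⊥, hb⟩ (by
    intro μ hμ
    refine coeff_schur_eq_zero fun h => hμ ?_
    apply Subtype.ext
    apply YoungDiagram.ext
    exact Finset.card_eq_zero.mp (by simpa using h.symm))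
  have := h0.unique h1
  rw [MvPowerSeries.coeff_zero_eq_constantCoeff_apply,
    MvPowerSeries.coeff_zero_eq_constantCoeff_apply, constantCoeff_schur_bot] at this
  exact this

theorem hasSubst_evenSchurSum : PowerSeries.HasSubst (evenSchurSum - 1) :=
  PowerSeries.HasSubst.of_constantCoeff_zero (by simp [constantCoeff_evenSchurSum])

theorem summable_X_pow {r : ℕ} (hr : r ≠ 0) :
    Summable fun i : ℕ => (MvPowerSeries.X i : MvPowerSeries ℕ ℚ) ^ r := by
  rw [MvPowerSeries.WithPiTopology.summable_iff_summable_coeff]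
  intro d
  refine summable_of_hasFiniteSupport (d.support.finite_toSet.subset ?_)
  intro i hi
  rw [Function.mem_support, MvPowerSeries.coeff_X_pow] at hi
  have hd : d = Finsupp.single i r := by
    by_contra h
    simp [h] at hi
  simp [hd, hr]

/-- The power sum `p_r` is homogeneous of degree `r`. -/
theorem coeff_powerSum_eq_zero {r : ℕ} (hr : r ≠ 0) {d : ℕ →₀ ℕ} (h : d.degree ≠ r) :
    MvPowerSeries.coeff d (powerSum r) = 0 := by
  have hs := (summable_X_pow hr).hasSum
  rw [MvPowerSeries.WithPiTopology.hasSum_iff_hasSum_coeff] at hs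
  refine (hs d).unique ?_
  convert hasSum_zero with i
  rw [MvPowerSeries.coeff_X_pow, if_neg]
  rintro rfl
  simp at h

theorem constantCoeff_powerSum {r : ℕ} (hr : r ≠ 0) :
    MvPowerSeries.constantCoeff (powerSum r) = 0 := by
  rw [← MvPowerSeries.coeff_zero_eq_constantCoeff_apply]
  exact coeff_powerSum_eq_zero hr (by simpa using hr.symm)

theorem coeff_powerSum_sq_eq_zero {r : ℕ} (hr : r ≠ 0) {d : ℕ →₀ ℕ} (h : d.degree ≠ r + r) :
    MvPowerSeries.coeff d (powerSum r ^ 2) = 0 := by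
  rw [sq, MvPowerSeries.coeff_mul]
  refine Finset.sum_eq_zero fun e he => ?_
  replace he : e.1 + e.2 = d := by simpa using he
  by_cases h1 : e.1.degree = r
  · have h2 : e.2.degree ≠ r := by
      intro h2
      apply h
      rw [← he, map_add, h1, h2]
    rw [coeff_powerSum_eq_zero hr h2, mul_zero]
  · rw [coeff_powerSum_eq_zero hr h1, zero_mul]

theorem summable_powerSum_sq :
    Summable fun n : ℕ+ => (1 / (4 * (n : ℚ))) • powerSum (2 * n) ^ 2 := by
  rw [MvPowerSeries.WithPiTopology.summable_iff_summable_coeff]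
  intro d
  refine summable_of_hasFiniteSupport
    (((Set.finite_Iic d.degree).preimage PNat.coe_injective.injOn).subset ?_)
  intro n hn
  by_contra h
  apply hn
  simp only [Set.mem_preimage, Set.mem_Iic, not_le] at h
  have hp := n.pos
  simp only [map_smul]
  rw [coeff_powerSum_sq_eq_zero (by omega) (by omega), smul_zero]

theorem hasSubst_oddPowerSum : MvPowerSeries.HasSubst fun k : ℕ => powerSum (2 * k + 1) where
  const_coeff k := by
    rw [constantCoeff_powerSum (by omega)]
    exact IsNilpotent.zero
  coeff_zero d := by
    refine (Set.finite_Iic d.degree).subset fun k hk => ?_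
    by_contra h
    simp only [Set.mem_Iic, not_le] at h
    exact hk (coeff_powerSum_eq_zero (by omega) (by omega))

/-- The ring `ℚ[[p_1, p_3, p_5, …]]` of formal power series in the odd power sums: the image of
`ℚ[[t_0, t_1, t_2, …]]` under the substitution `t_k ↦ p_{2k+1}`. -/
noncomputable def oddPowerSumSeries : Subalgebra ℚ (MvPowerSeries ℕ ℚ) :=
  (MvPowerSeries.substAlgHom (R := ℚ) hasSubst_oddPowerSum).range

end SymmFn

namespace SymmFn

/-! ### Young diagrams through their row lengths -/

/-! Everything is tested on finite lists `l` of rationals, graded by degree. Let B(l) be the series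
of values at `l` of the Schur functions of shapes with both λ and λ' even; these are the shapes
tiled by 2×2 blocks. The heart of the proof is the effect on B of adjoining a pair `t, -t`
(`blockSeries_cons_cons_neg`): B(t, -t, l) · (1 - t⁴X⁴) · ∏_{x ∈ l} (1 - t²x²X⁴) = B(l). Since
p_{2n}(t, -t, l) = 2t^{2n} + p_{2n}(l), the logarithms of the two factors are exactly what ∑
p_{2n}²/(4n) gains, so the reduced logarithm log B - ∑ p_{2n}² X^{4n}/(4n) does not see the pair
(`reducedLog_cons_cons_neg`).

Adjoining opposite pairs leaves odd power sums alone. Adjoining `t, -t` for every entry `t` of `l`,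
`m` times over, multiplies each even power sum by 1 + 2m. Each coefficient of the reduced logarithm
is one polynomial in the power sums, valid for all lists; as a polynomial in `m` it is constant on
ℕ, hence constant, and m = -1/2 removes the even power sums (`exists_coeff_reducedLog_eq`).

For the pair identity, write ≺ for removal of a horizontal strip. Branching twice expands B(t, -t,
l) in s_μ(l), with coefficients signed sums over chains μ ≺ ν ≺ ρ, ρ a block shape. Since ∏(1 -
t²x²X⁴)⁻¹ = H(t)H(-t), where H(t) = ∑ t^j h_j(l) X^{2j}, two applications of the Pieri rule expand
B(l)H(t)H(-t) through chains ρ ≺ ν ≺ μ. The two signed sums are compared for each μ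
(`sum_blocksAbove`): both vanish by a sign-reversing involution if some rows 2k, 2k+1 of μ have
lengths of different parity, and otherwise reflecting intervals gives a bijection. One row of the
upper chain is unbounded and contributes the geometric series 1/(1 - t⁴X⁴).

The Pieri rule itself comes from the branching rule and a local reflection rule
(`card_above_inter`). Finally, a power series is determined by its graded evaluations, and scaling
the variables isolates weights, which transfers the result from lists to formal series
(`mem_oddPowerSumSeries_of_gradedEval`). -/

theorem rowLen_ext {μ ν : YoungDiagram} (h : ∀ i, μ.rowLen i = ν.rowLen i) : μ = ν := by
  ext ⟨i, j⟩
  rw [YoungDiagram.mem_cells, YoungDiagram.mem_cells, YoungDiagram.mem_iff_lt_rowLen,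
    YoungDiagram.mem_iff_lt_rowLen, h]

theorem rowLen_antitone (μ : YoungDiagram) : Antitone μ.rowLen :=
  fun i j h => μ.rowLen_anti i j h

theorem rowLen_eq_zero {μ : YoungDiagram} {i : ℕ} (h : μ.card ≤ i) : μ.rowLen i = 0 := by
  by_contra h0
  have hi : (i, 0) ∈ μ := YoungDiagram.mem_iff_lt_rowLen.mpr (Nat.pos_of_ne_zero h0)
  have hsub : (Finset.range (i + 1)).image (fun a => (a, 0)) ⊆ μ.cells := by
    intro c hc
    obtain ⟨a, ha, rfl⟩ := Finset.mem_image.mp hc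
    exact μ.up_left_mem (by simp at ha; omega) le_rfl hi
  have := Finset.card_le_card hsub
  rw [Finset.card_image_of_injective _ (fun a b hab => by simpa using hab),
    Finset.card_range] at this
  have h' : μ.cells.card ≤ i := h
  omega

theorem card_eq_sum_rowLen {μ : YoungDiagram} {K : ℕ} (h : μ.rowLen K = 0) :
    μ.card = ∑ i ∈ Finset.range K, μ.rowLen i := by
  have : ∀ c ∈ μ.cells, c.1 ∈ Finset.range K := by
    rintro ⟨i, j⟩ hc
    by_contra hK
    have h1 := rowLen_antitone μ (by simpa using hK : K ≤ i)
    have h2 := YoungDiagram.mem_iff_lt_rowLen.mp hc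
    omega
  rw [YoungDiagram.card, Finset.card_eq_sum_card_fiberwise this]
  exact Finset.sum_congr rfl fun i _ => (YoungDiagram.rowLen_eq_card μ).symm

theorem card_eq_sum_rowLen_of_le {μ : YoungDiagram} {K : ℕ} (h : μ.card ≤ K) :
    μ.card = ∑ i ∈ Finset.range K, μ.rowLen i :=
  card_eq_sum_rowLen (rowLen_eq_zero h)

open Classical in
/-- The Young diagram with row lengths `f`, if there is one. -/
noncomputable def diagram (f : ℕ → ℕ) : YoungDiagram :=
  if h : ∃ μ : YoungDiagram, ∀ i, μ.rowLen i = f i then h.choose else ⊥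

/-- A weakly decreasing sequence that reaches zero has finitely many cells below it, and they form a
lower set. Later bijections are all given by formulas for row lengths; this lemma turns such
formulas into shapes, so that only inequalities between row lengths remain to be checked. -/
theorem rowLen_diagram {f : ℕ → ℕ} (hf : ∀ i, f (i + 1) ≤ f i) {K : ℕ} (hK : f K = 0) (i : ℕ) :
    (diagram f).rowLen i = f i := by
  have hf' : Antitone f := antitone_nat_of_succ_le hf
  have h : ∃ μ : YoungDiagram, ∀ i, μ.rowLen i = f i := by
    refine ⟨⟨(Finset.range K).sigma (fun i => Finset.range (f i)) |>.image
      (fun c => (c.1, c.2)), ?_⟩, fun i => ?_⟩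
    · rintro ⟨a, b⟩ ⟨c, d⟩ ⟨h1, h2⟩ h
      simp only [Finset.coe_image, Set.mem_image, Finset.mem_coe, Finset.mem_sigma,
        Finset.mem_range, Sigma.exists, Prod.mk.injEq] at h ⊢
      obtain ⟨_, _, ⟨h3, h4⟩, rfl, rfl⟩ := h
      simp only at h1 h2
      have := hf' h1
      exact ⟨c, d, ⟨by omega, by omega⟩, rfl, rfl⟩
    · refine eq_of_forall_lt_iff fun j => ?_
      rw [← YoungDiagram.mem_iff_lt_rowLen, ← YoungDiagram.mem_cells]
      simp only [Finset.mem_image, Finset.mem_sigma, Finset.mem_range, Sigma.exists,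
        Prod.mk.injEq]
      constructor
      · rintro ⟨_, _, ⟨h3, h4⟩, rfl, rfl⟩
        exact h4
      · intro h
        refine ⟨i, j, ⟨?_, h⟩, rfl, rfl⟩
        by_contra hi
        have := hf' (not_lt.mp hi)
        omega
  rw [diagram, dif_pos h]
  exact h.choose_spec i

theorem diagram_eq {f : ℕ → ℕ} {μ : YoungDiagram} (h : ∀ i, f i = μ.rowLen i) :
    diagram f = μ := by
  have hf : f = μ.rowLen := funext h
  subst hf
  exact rowLen_ext (rowLen_diagram (fun i => rowLen_antitone μ i.le_succ)
    (rowLen_eq_zero le_rfl))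

/-! ### Horizontal strips -/

/-- `μ / κ` is a horizontal strip: the row lengths interlace. -/
def HStrip (κ μ : YoungDiagram) : Prop :=
  ∀ i, μ.rowLen (i + 1) ≤ κ.rowLen i ∧ κ.rowLen i ≤ μ.rowLen i

theorem HStrip.le {κ μ : YoungDiagram} (h : HStrip κ μ) : κ ≤ μ := by
  rintro ⟨i, j⟩ hc
  rw [YoungDiagram.mem_iff_lt_rowLen] at *
  exact hc.trans_le (h i).2

theorem HStrip.card_le {κ μ : YoungDiagram} (h : HStrip κ μ) : κ.card ≤ μ.card :=
  Finset.card_le_card h.le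

theorem finite_card_le (n : ℕ) : {μ : YoungDiagram | μ.card ≤ n}.Finite := by
  have : {μ : YoungDiagram | μ.card ≤ n} = ⋃ k ∈ Set.Iic n, {μ : YoungDiagram | μ.card = k} := by
    ext; simp
  rw [this]
  exact (Set.finite_Iic n).biUnion fun k _ => finite_card_eq k

/-- The Young diagrams with at most `n` cells. -/
noncomputable def upTo (n : ℕ) : Finset YoungDiagram := (finite_card_le n).toFinset

@[simp] theorem mem_upTo {n : ℕ} {μ : YoungDiagram} : μ ∈ upTo n ↔ μ.card ≤ n := by
  simp [upTo]

open Classical in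
/-- The Young diagrams obtained from `μ` by removing a horizontal strip. -/
noncomputable def below (μ : YoungDiagram) : Finset YoungDiagram :=
  {κ ∈ upTo μ.card | HStrip κ μ}

open Classical in
/-- The Young diagrams with `n` cells obtained from `κ` by adding a horizontal strip. -/
noncomputable def above (κ : YoungDiagram) (n : ℕ) : Finset YoungDiagram :=
  {μ ∈ upTo n | HStrip κ μ ∧ μ.card = n}

@[simp] theorem mem_below {κ μ : YoungDiagram} : κ ∈ below μ ↔ HStrip κ μ := by
  simp only [below, Finset.mem_filter, mem_upTo, and_iff_right_iff_imp]
  exact HStrip.card_le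

@[simp] theorem mem_above {κ μ : YoungDiagram} {n : ℕ} :
    μ ∈ above κ n ↔ HStrip κ μ ∧ μ.card = n := by
  simp only [above, Finset.mem_filter, mem_upTo, and_iff_right_iff_imp]
  exact fun h => h.2.le

theorem card_eq_rowLen_zero_add {μ : YoungDiagram} {K : ℕ} (h : μ.card ≤ K) :
    μ.card = μ.rowLen 0 + ∑ i ∈ Finset.range K, μ.rowLen (i + 1) := by
  rw [card_eq_sum_rowLen_of_le (h.trans K.le_succ), Finset.sum_range_succ', add_comm]

/-- If a common lower neighbour `ρ` and a common upper neighbour `ν` of `α` and `β` correspond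
under reflection of each interlacing interval, their sizes determine each other. -/
theorem card_add_card_of_reflect {α β ν ρ : YoungDiagram}
    (h : ∀ i, ν.rowLen (i + 1) + ρ.rowLen i = max (α.rowLen (i + 1)) (β.rowLen (i + 1))
      + min (α.rowLen i) (β.rowLen i)) :
    ν.card + ρ.card + max (α.rowLen 0) (β.rowLen 0) = α.card + β.card + ν.rowLen 0 := by
  obtain ⟨K, hα, hβ, hν, hρ⟩ : ∃ K, α.card ≤ K ∧ β.card ≤ K ∧ ν.card ≤ K ∧ ρ.card ≤ K :=
    ⟨α.card + β.card + ν.card + ρ.card, by omega, by omega, by omega, by omega⟩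
  have h1 := Finset.sum_congr (s₁ := Finset.range K) rfl fun i _ => h i
  have h2 : ∑ i ∈ Finset.range K, max (α.rowLen (i + 1)) (β.rowLen (i + 1))
      + max (α.rowLen 0) (β.rowLen 0)
      = ∑ i ∈ Finset.range K, max (α.rowLen i) (β.rowLen i) := by
    rw [← Finset.sum_range_succ' (fun i => max (α.rowLen i) (β.rowLen i)),
      Finset.sum_range_succ, rowLen_eq_zero hα, rowLen_eq_zero hβ]
    simp
  have h3 : ∑ i ∈ Finset.range K, max (α.rowLen i) (β.rowLen i)
      + ∑ i ∈ Finset.range K, min (α.rowLen i) (β.rowLen i) = α.card + β.card := by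
    rw [card_eq_sum_rowLen_of_le hα, card_eq_sum_rowLen_of_le hβ, ← Finset.sum_add_distrib,
      ← Finset.sum_add_distrib]
    exact Finset.sum_congr rfl fun i _ => max_add_min _ _
  rw [Finset.sum_add_distrib, Finset.sum_add_distrib] at h1
  have h4 := card_eq_rowLen_zero_add hν
  have h5 := card_eq_sum_rowLen_of_le hρ
  omega

open Classical in
/-- The local rule behind the commutation of adding and removing horizontal strips. -/
theorem card_above_inter (α β : YoungDiagram) (n : ℕ) :
    {ν ∈ above α n | HStrip β ν}.card
      = {ρ ∈ below α | HStrip ρ β ∧ α.card + β.card ≤ n + ρ.card}.card := by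
  -- Row `i` of a common lower neighbour and row `i + 1` of a common upper neighbour range over the
  -- same interval, from `max (α_{i+1}) (β_{i+1})` to `min α_i β_i`; `F` and `G` reflect it. Row 0
  -- of the upper neighbour is bounded only from below, so in `G` it is fixed by the size `n`. The
  -- inequality on sizes says that this row is long enough.
  let F : YoungDiagram → ℕ → ℕ := fun ν i =>
    max (α.rowLen (i + 1)) (β.rowLen (i + 1)) + min (α.rowLen i) (β.rowLen i) - ν.rowLen (i + 1)
  let G : YoungDiagram → ℕ → ℕ := fun ρ i => Nat.casesOn i
    (max (α.rowLen 0) (β.rowLen 0) + (n + ρ.card - (α.card + β.card)))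
    (fun i => max (α.rowLen (i + 1)) (β.rowLen (i + 1)) + min (α.rowLen i) (β.rowLen i)
      - ρ.rowLen i)
  have G0 : ∀ ρ, G ρ 0 = max (α.rowLen 0) (β.rowLen 0) + (n + ρ.card - (α.card + β.card)) :=
    fun _ => rfl
  have GS : ∀ ρ i, G ρ (i + 1) = max (α.rowLen (i + 1)) (β.rowLen (i + 1))
      + min (α.rowLen i) (β.rowLen i) - ρ.rowLen i := fun _ _ => rfl
  have hF : ∀ ν, HStrip α ν → HStrip β ν → ∀ i, (diagram (F ν)).rowLen i = F ν i := by
    intro ν h1 h2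
    refine rowLen_diagram (K := α.card) (fun i => ?_) ?_
    · have := h1 i; have := h1 (i + 1); have := h2 i; have := h2 (i + 1)
      have := h1 (i + 1 + 1); have := h2 (i + 1 + 1)
      simp only [F]; omega
    · simp only [F]
      have := rowLen_eq_zero (le_refl α.card)
      have : α.rowLen (α.card + 1) = 0 := rowLen_eq_zero (Nat.le_succ _)
      have := h1 α.card; have := h2 α.card; have := (h2 (α.card + 1)).2
      omega
  have hG : ∀ ρ, HStrip ρ α → HStrip ρ β → ∀ i, (diagram (G ρ)).rowLen i = G ρ i := by
    intro ρ h1 h2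
    refine rowLen_diagram (K := α.card + 1) (fun i => ?_) ?_
    · rcases i with _ | i
      · have := h1 0; have := h2 0
        simp only [G0, GS] at *; omega
      · have := h1 i; have := h1 (i + 1); have := h2 i; have := h2 (i + 1)
        simp only [G0, GS] at *; omega
    · simp only [GS]
      have := rowLen_eq_zero (le_refl α.card)
      have : α.rowLen (α.card + 1) = 0 := rowLen_eq_zero (Nat.le_succ _)
      have := h1 α.card; have := h2 α.card
      omega
  refine Finset.card_nbij' (fun ν => diagram (F ν)) (fun ρ => diagram (G ρ)) ?_ ?_ ?_ ?_
  · intro ν hν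
    simp only [Finset.coe_filter, mem_above, mem_below, Set.mem_ofPred_eq] at hν ⊢
    obtain ⟨⟨h1, h3⟩, h2⟩ := hν
    have key := card_add_card_of_reflect (α := α) (β := β) (ν := ν) (ρ := diagram (F ν))
      (fun i => by
        rw [hF ν h1 h2]
        have := h1 i; have := h2 i; have := h1 (i + 1); have := h2 (i + 1)
        simp only [F]; omega)
    refine ⟨fun i => ?_, fun i => ?_, ?_⟩
    · rw [hF ν h1 h2]
      have := h1 i; have := h2 i; have := h1 (i + 1); have := h2 (i + 1)
      simp only [F]; omega
    · rw [hF ν h1 h2]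
      have := h1 i; have := h2 i; have := h1 (i + 1); have := h2 (i + 1)
      simp only [F]; omega
    · have := h1 0; have := h2 0
      omega
  · intro ρ hρ
    simp only [Finset.coe_filter, mem_above, mem_below, Set.mem_ofPred_eq] at hρ ⊢
    obtain ⟨h1, h2, h3⟩ := hρ
    have key := card_add_card_of_reflect (α := α) (β := β) (ν := diagram (G ρ)) (ρ := ρ)
      (fun i => by
        rw [hG ρ h1 h2]
        have := h1 i; have := h2 i
        simp only [G0, GS] at *; omega)
    have h0 := hG ρ h1 h2 0
    rw [G0] at h0
    refine ⟨⟨fun i => ?_, by omega⟩, fun i => ?_⟩ <;>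
    · rw [hG ρ h1 h2, hG ρ h1 h2]
      have := h1 i; have := h2 i
      rcases i with _ | i
      · simp only [G0, GS] at *; omega
      · have := h1 (i + 1); have := h2 (i + 1); have := h1 i; have := h2 i
        simp only [G0, GS] at *; omega
  · intro ν hν
    simp only [Finset.coe_filter, mem_above, Set.mem_ofPred_eq] at hν
    obtain ⟨⟨h1, h3⟩, h2⟩ := hν
    have key := card_add_card_of_reflect (α := α) (β := β) (ν := ν) (ρ := diagram (F ν))
      (fun i => by
        rw [hF ν h1 h2]
        have := h1 i; have := h2 i; have := h1 (i + 1); have := h2 (i + 1)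
        simp only [F]; omega)
    refine diagram_eq fun i => ?_
    rcases i with _ | i
    · have := h1 0; have := h2 0
      simp only [G0, GS] at *; omega
    · simp only [GS]
      rw [hF ν h1 h2]
      have := h1 i; have := h2 i; have := h1 (i + 1); have := h2 (i + 1)
      simp only [F]; omega
  · intro ρ hρ
    simp only [Finset.coe_filter, mem_below, Set.mem_ofPred_eq] at hρ
    obtain ⟨h1, h2, h3⟩ := hρ
    refine diagram_eq fun i => ?_
    have := h1 i; have := h2 i
    simp only [F]
    rw [hG ρ h1 h2]
    simp only [G0, GS] at *; omega

/-! ### Schur functions and complete homogeneous functions at finitely many points -/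

/-- The value of the Schur function of shape `μ` at a list of numbers, by the branching rule. -/
noncomputable def schurEval : List ℚ → YoungDiagram → ℚ
  | [], μ => open Classical in if μ = ⊥ then 1 else 0
  | x :: l, μ => ∑ κ ∈ below μ, x ^ (μ.card - κ.card) * schurEval l κ

/-- The value of the complete homogeneous symmetric function of degree `n` at a list of numbers. -/
def hEval : List ℚ → ℕ → ℚ
  | [], n => if n = 0 then 1 else 0
  | x :: l, n => ∑ k ∈ Finset.range (n + 1), x ^ (n - k) * hEval l k

theorem hStrip_bot_right {κ : YoungDiagram} : HStrip κ ⊥ ↔ κ = ⊥ := by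
  constructor
  · intro h
    exact le_bot_iff.mp h.le
  · rintro rfl i
    simp [rowLen_eq_zero (μ := ⊥) (Nat.zero_le _)]

/-- The Pieri rule. -/
theorem sum_above_schurEval (l : List ℚ) (μ : YoungDiagram) (j : ℕ) :
    ∑ ν ∈ above μ (μ.card + j), schurEval l ν = hEval l j * schurEval l μ := by
  classical
  induction l generalizing μ j with
  | nil =>
    simp only [schurEval, hEval, Finset.sum_ite_eq', mem_above, hStrip_bot_right]
    by_cases hμ : μ = ⊥
    · subst hμ
      have : (⊥ : YoungDiagram).card = 0 := rfl
      simp [this, eq_comm]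
    · simp [hμ]
  | cons x l ih =>
    set n := μ.card + j with hn
    have h1 : ∀ ν ∈ above μ n, schurEval (x :: l) ν
        = ∑ κ ∈ upTo n, if HStrip κ ν then x ^ (n - κ.card) * schurEval l κ else 0 := by
      intro ν hν
      rw [mem_above] at hν
      rw [schurEval, ← Finset.sum_filter]
      refine Finset.sum_congr ?_ fun κ _ => by rw [hν.2]
      ext κ
      simp only [mem_below, Finset.mem_filter, mem_upTo, iff_and_self]
      exact fun h => h.card_le.trans hν.2.le
    -- After peeling off `x`, both sides are sums over `κ`. The local rule replaces common upper
    -- neighbours of `μ` and `κ` by common lower neighbours `ρ`, and the induction hypothesis is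
    -- then applied to each `ρ`.
    rw [Finset.sum_congr rfl h1, Finset.sum_comm]
    have h2 : ∀ κ ∈ upTo n, ∑ ν ∈ above μ n,
        (if HStrip κ ν then x ^ (n - κ.card) * schurEval l κ else 0)
        = ∑ ρ ∈ below μ, if HStrip ρ κ ∧ κ.card ≤ ρ.card + j then
            x ^ (n - κ.card) * schurEval l κ else 0 := by
      intro κ _
      rw [← Finset.sum_filter, ← Finset.sum_filter, Finset.sum_const, Finset.sum_const,
        card_above_inter]
      congr 2
      refine Finset.filter_congr fun ρ _ => and_congr_right fun _ => ?_
      omega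
    rw [Finset.sum_congr rfl h2, Finset.sum_comm, schurEval, Finset.mul_sum]
    refine Finset.sum_congr rfl fun ρ hρ => ?_
    have hρc := (mem_below.mp hρ).card_le
    -- Group the `κ` above `ρ` by the size `k` of the strip, so that the inner sum is a Pieri sum
    -- for `l`.
    have h3 : ∑ κ ∈ upTo n, (if HStrip ρ κ ∧ κ.card ≤ ρ.card + j then
            x ^ (n - κ.card) * schurEval l κ else 0)
        = ∑ k ∈ Finset.range (j + 1), ∑ κ ∈ above ρ (ρ.card + k),
            x ^ (n - κ.card) * schurEval l κ := by
      rw [← Finset.sum_filter, Finset.sum_sigma']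
      refine Finset.sum_nbij' (fun κ => ⟨κ.card - ρ.card, κ⟩) (fun p => p.2) ?_ ?_ ?_ ?_ ?_
      · intro κ hκ
        simp only [Finset.mem_filter, mem_upTo, Finset.mem_sigma, Finset.mem_range,
          mem_above] at hκ ⊢
        have := hκ.2.1.card_le
        exact ⟨by omega, hκ.2.1, by omega⟩
      · rintro ⟨k, κ⟩ hκ
        simp only [Finset.mem_filter, mem_upTo, Finset.mem_sigma, Finset.mem_range,
          mem_above] at hκ ⊢
        exact ⟨by omega, hκ.2.1, by omega⟩
      · intro κ _; rfl
      · rintro ⟨k, κ⟩ hκ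
        simp only [Finset.mem_sigma, mem_above] at hκ ⊢
        rw [hκ.2.2]
        simp
      · intro κ _; rfl
    rw [h3, hEval, Finset.sum_mul]
    refine Finset.sum_congr rfl fun k hk => ?_
    rw [Finset.mem_range] at hk
    have h4 : ∀ κ ∈ above ρ (ρ.card + k), x ^ (n - κ.card) * schurEval l κ
        = x ^ (j - k) * x ^ (μ.card - ρ.card) * schurEval l κ := by
      intro κ hκ
      rw [(mem_above.mp hκ).2, ← pow_add]
      congr 2
      omega
    rw [Finset.sum_congr rfl h4, ← Finset.mul_sum, ih]
    ring

/-! ### Partitions built from two by two blocks -/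

/-- All row lengths are even and the rows come in pairs of equal length. -/
def IsBlock (μ : YoungDiagram) : Prop :=
  ∀ k, Even (μ.rowLen (2 * k)) ∧ μ.rowLen (2 * k + 1) = μ.rowLen (2 * k)

theorem forall_nat_iff_two_mul {p : ℕ → Prop} :
    (∀ i, p i) ↔ ∀ k, p (2 * k) ∧ p (2 * k + 1) := by
  refine ⟨fun h k => ⟨h _, h _⟩, fun h i => ?_⟩
  obtain ⟨k, hk⟩ | ⟨k, hk⟩ := Nat.even_or_odd i
  · rw [hk, ← two_mul]; exact (h k).1
  · rw [hk]; exact (h k).2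

/-- A column has odd length `2m + 1` exactly when its index lies between the lengths of rows `2m +
1` and `2m`; so all columns are even exactly when rows `2m` and `2m + 1` always agree. -/
theorem isEven_and_transpose_iff (μ : YoungDiagram) :
    IsEven μ ∧ IsEven μ.transpose ↔ IsBlock μ := by
  have key : ∀ i j, i < μ.colLen j ↔ j < μ.rowLen i := fun i j => by
    rw [← YoungDiagram.mem_iff_lt_colLen, YoungDiagram.mem_iff_lt_rowLen]
  simp only [IsEven, YoungDiagram.rowLen_transpose, IsBlock]
  constructor
  · rintro ⟨h1, h2⟩ k
    refine ⟨h1 _, ?_⟩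
    by_contra hne
    have hlt : μ.rowLen (2 * k + 1) < μ.rowLen (2 * k) :=
      lt_of_le_of_ne (rowLen_antitone μ (Nat.le_succ _)) hne
    have h3 := (key (2 * k) (μ.rowLen (2 * k + 1))).mpr hlt
    have h4 := mt (key (2 * k + 1) (μ.rowLen (2 * k + 1))).mp (lt_irrefl _)
    obtain ⟨m, hm⟩ := h2 (μ.rowLen (2 * k + 1))
    omega
  · intro h
    refine ⟨forall_nat_iff_two_mul.mpr fun k => ⟨(h k).1, (h k).2 ▸ (h k).1⟩, fun j => ?_⟩
    by_contra hodd
    obtain ⟨m, hm⟩ := Nat.not_even_iff_odd.mp hodd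
    have h3 := (key (2 * m) j).mp (by omega)
    rw [← (h m).2] at h3
    have h4 := (key (2 * m + 1) j).mpr h3
    omega

theorem sum_range_two_mul {M : Type*} [AddCommMonoid M] (f : ℕ → M) (K : ℕ) :
    ∑ i ∈ Finset.range (2 * K), f i = ∑ k ∈ Finset.range K, (f (2 * k) + f (2 * k + 1)) := by
  induction K with
  | zero => simp
  | succ K ih => rw [Nat.mul_succ, Finset.sum_range_succ, Finset.sum_range_succ, ih,
      Finset.sum_range_succ _ K, add_assoc]

theorem card_eq_sum_pairs {μ : YoungDiagram} {K : ℕ} (h : μ.card ≤ K) :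
    μ.card = ∑ k ∈ Finset.range K, (μ.rowLen (2 * k) + μ.rowLen (2 * k + 1)) := by
  rw [← sum_range_two_mul]
  exact card_eq_sum_rowLen_of_le (by omega)

/-- The sequence with `a` in the even and `b` in the odd places. -/
def interleave (a b : ℕ → ℕ) (i : ℕ) : ℕ :=
  if i % 2 = 0 then a (i / 2) else b (i / 2)

theorem interleave_two_mul (a b : ℕ → ℕ) (k : ℕ) : interleave a b (2 * k) = a k := by
  simp [interleave]

theorem interleave_two_mul_add_one (a b : ℕ → ℕ) (k : ℕ) :
    interleave a b (2 * k + 1) = b k := by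
  have h1 : (2 * k + 1) % 2 = 1 := by omega
  have h2 : (2 * k + 1) / 2 = k := by omega
  simp [interleave, h1, h2]

theorem rowLen_diagram_interleave {a b : ℕ → ℕ} (h1 : ∀ k, b k ≤ a k)
    (h2 : ∀ k, a (k + 1) ≤ b k) {K : ℕ} (hK : a K = 0) (k : ℕ) :
    (diagram (interleave a b)).rowLen (2 * k) = a k ∧
      (diagram (interleave a b)).rowLen (2 * k + 1) = b k := by
  have h := rowLen_diagram (f := interleave a b) (K := 2 * K)
    (forall_nat_iff_two_mul.mpr fun k => by
      rw [show 2 * k + 1 + 1 = 2 * (k + 1) by ring]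
      simp only [interleave_two_mul, interleave_two_mul_add_one]
      exact ⟨h1 k, h2 k⟩) (by rw [interleave_two_mul, hK])
  rw [h, h, interleave_two_mul, interleave_two_mul_add_one]
  exact ⟨rfl, rfl⟩

theorem diagram_interleave_eq {a b : ℕ → ℕ} {μ : YoungDiagram}
    (h : ∀ k, a k = μ.rowLen (2 * k) ∧ b k = μ.rowLen (2 * k + 1)) :
    diagram (interleave a b) = μ :=
  diagram_eq (forall_nat_iff_two_mul.mpr fun k => by
    rw [interleave_two_mul, interleave_two_mul_add_one]; exact h k)

/-- `μ ≺ ν ≺ ρ` with `ρ` built from blocks. -/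
theorem isBlock_above_iff {μ ν ρ : YoungDiagram} :
    IsBlock ρ ∧ HStrip ν ρ ∧ HStrip μ ν ↔
      ∀ k, ρ.rowLen (2 * k) % 2 = 0 ∧ ρ.rowLen (2 * k + 1) = ρ.rowLen (2 * k) ∧
        ν.rowLen (2 * k) = ρ.rowLen (2 * k) ∧ μ.rowLen (2 * k) ≤ ρ.rowLen (2 * k) ∧
        ρ.rowLen (2 * k + 2) ≤ μ.rowLen (2 * k + 1) ∧
        μ.rowLen (2 * k + 1) ≤ ν.rowLen (2 * k + 1) ∧
        ν.rowLen (2 * k + 1) ≤ μ.rowLen (2 * k) := by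
  simp only [IsBlock, HStrip, Nat.even_iff]
  constructor
  · rintro ⟨h1, h2, h3⟩ k
    have := h1 k; have := h1 (k + 1)
    have := h2 (2 * k); have := h2 (2 * (k + 1)); have := h3 (2 * k); have := h3 (2 * k + 1)
    simp only [mul_add, mul_one, add_assoc, Nat.reduceAdd] at *
    omega
  · intro h
    refine ⟨fun k => ⟨(h k).1, (h k).2.1⟩, forall_nat_iff_two_mul.mpr fun k => ?_,
      forall_nat_iff_two_mul.mpr fun k => ?_⟩ <;>
    · have := h k; have := h (k + 1)
      simp only [mul_add, mul_one, add_assoc, Nat.reduceAdd] at *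
      omega

/-- `ρ ≺ ν ≺ μ` with `ρ` built from blocks. -/
theorem isBlock_below_iff {μ ν ρ : YoungDiagram} :
    IsBlock ρ ∧ HStrip ρ ν ∧ HStrip ν μ ↔
      ∀ k, ρ.rowLen (2 * k) % 2 = 0 ∧ ρ.rowLen (2 * k + 1) = ρ.rowLen (2 * k) ∧
        ν.rowLen (2 * k + 1) = ρ.rowLen (2 * k) ∧ μ.rowLen (2 * k + 2) ≤ ρ.rowLen (2 * k) ∧
        ρ.rowLen (2 * k) ≤ μ.rowLen (2 * k + 1) ∧
        μ.rowLen (2 * k + 1) ≤ ν.rowLen (2 * k) ∧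
        ν.rowLen (2 * k) ≤ μ.rowLen (2 * k) := by
  simp only [IsBlock, HStrip, Nat.even_iff]
  constructor
  · rintro ⟨h1, h2, h3⟩ k
    have := h1 k
    have := h2 (2 * k); have := h2 (2 * k + 1); have := h3 (2 * k); have := h3 (2 * k + 1)
    simp only [add_assoc, Nat.reduceAdd] at *
    omega
  · intro h
    refine ⟨fun k => ⟨(h k).1, (h k).2.1⟩, forall_nat_iff_two_mul.mpr fun k => ?_,
      forall_nat_iff_two_mul.mpr fun k => ?_⟩ <;>
    · have := h k; have := h (k + 1)
      simp only [mul_add, mul_one, add_assoc, Nat.reduceAdd] at *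
      omega

open Classical in
/-- Pairs `(ν, ρ)` with `μ ≺ ν ≺ ρ` and `ρ` built from blocks, of size `n`. -/
noncomputable def blocksAbove (μ : YoungDiagram) (n : ℕ) : Finset (YoungDiagram × YoungDiagram) :=
  {p ∈ upTo n ×ˢ upTo n | (IsBlock p.2 ∧ HStrip p.1 p.2 ∧ HStrip μ p.1) ∧ p.2.card = n}

open Classical in
/-- Pairs `(ν, ρ)` with `ρ ≺ ν ≺ μ` and `ρ` built from blocks. -/
noncomputable def blocksBelow (μ : YoungDiagram) : Finset (YoungDiagram × YoungDiagram) :=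
  {p ∈ upTo μ.card ×ˢ upTo μ.card | IsBlock p.2 ∧ HStrip p.2 p.1 ∧ HStrip p.1 μ}

theorem mem_blocksAbove {μ : YoungDiagram} {n : ℕ} {p : YoungDiagram × YoungDiagram} :
    p ∈ blocksAbove μ n ↔ (IsBlock p.2 ∧ HStrip p.1 p.2 ∧ HStrip μ p.1) ∧ p.2.card = n := by
  simp only [blocksAbove, Finset.mem_filter, Finset.mem_product, mem_upTo, and_iff_right_iff_imp]
  exact fun h => ⟨h.1.2.1.card_le.trans h.2.le, h.2.le⟩

theorem mem_blocksBelow {μ : YoungDiagram} {p : YoungDiagram × YoungDiagram} :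
    p ∈ blocksBelow μ ↔ IsBlock p.2 ∧ HStrip p.2 p.1 ∧ HStrip p.1 μ := by
  simp only [blocksBelow, Finset.mem_filter, Finset.mem_product, mem_upTo, and_iff_right_iff_imp]
  exact fun h => ⟨h.2.2.card_le, h.2.1.card_le.trans h.2.2.card_le⟩

/-! #### The sign-reversing involution -/

/-- Reflect the length of row `k` in the interval `[lo, hi]`. -/
noncomputable def flipRow (ν : YoungDiagram) (k c : ℕ) : YoungDiagram :=
  diagram (Function.update ν.rowLen k (c - ν.rowLen k))

/-- The neighbouring rows lie outside the interval `[lo, hi]`, so the reflected row still fits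
between them. The condition on the row above is phrased with `j + 1 = k` to be void for `k = 0`. -/
theorem rowLen_flipRow {ν : YoungDiagram} {k lo hi : ℕ} (h1 : lo ≤ ν.rowLen k)
    (h2 : ν.rowLen k ≤ hi) (h3 : ν.rowLen (k + 1) ≤ lo) (h4 : ∀ j, j + 1 = k → hi ≤ ν.rowLen j)
    (i : ℕ) : (flipRow ν k (lo + hi)).rowLen i
      = if i = k then lo + hi - ν.rowLen k else ν.rowLen i := by
  rw [flipRow, rowLen_diagram (K := ν.card + k + 1)]
  · rw [Function.update_apply]
  · intro i
    have := rowLen_antitone ν i.le_succ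
    simp only [Function.update_apply]
    split_ifs with h5 h6 h6
    · omega
    · have := h4 i h5; omega
    · subst h6; omega
    · exact this
  · rw [Function.update_of_ne (by omega), rowLen_eq_zero (by omega)]

theorem card_flipRow {ν : YoungDiagram} {k lo hi : ℕ} (h1 : lo ≤ ν.rowLen k)
    (h2 : ν.rowLen k ≤ hi) (h3 : ν.rowLen (k + 1) ≤ lo)
    (h4 : ∀ j, j + 1 = k → hi ≤ ν.rowLen j) :
    (flipRow ν k (lo + hi)).card + 2 * ν.rowLen k = ν.card + (lo + hi) := by
  obtain ⟨K, hK1, hK2, hK3⟩ : ∃ K, ν.card ≤ K ∧ (flipRow ν k (lo + hi)).card ≤ K ∧ k < K :=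
    ⟨ν.card + (flipRow ν k (lo + hi)).card + k + 1, by omega, by omega, by omega⟩
  have e1 := card_eq_sum_rowLen_of_le hK1
  have e2 := card_eq_sum_rowLen_of_le hK2
  rw [← Finset.sum_erase_add _ _ (Finset.mem_range.mpr hK3)] at e1 e2
  have e3 : ∑ i ∈ (Finset.range K).erase k, (flipRow ν k (lo + hi)).rowLen i
      = ∑ i ∈ (Finset.range K).erase k, ν.rowLen i :=
    Finset.sum_congr rfl fun i hi => (rowLen_flipRow h1 h2 h3 h4 i).trans
      (if_neg (Finset.ne_of_mem_erase hi))
  rw [rowLen_flipRow h1 h2 h3 h4, if_pos rfl, e3] at e2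
  omega

/-- A flip changes the size by `lo + hi - 2 ν_k`, which is odd: the sign changes and there are no
fixed points. -/
theorem sum_sign_eq_zero {S : Finset (YoungDiagram × YoungDiagram)} {k lo hi : ℕ}
    (hodd : (lo + hi) % 2 = 1)
    (h : ∀ p ∈ S, lo ≤ p.1.rowLen k ∧ p.1.rowLen k ≤ hi ∧ p.1.rowLen (k + 1) ≤ lo ∧
      ∀ j, j + 1 = k → hi ≤ p.1.rowLen j)
    (hS : ∀ p ∈ S, (flipRow p.1 k (lo + hi), p.2) ∈ S) :
    ∑ p ∈ S, (-1 : ℚ) ^ p.1.card = 0 := by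
  refine Finset.sum_involution (fun p _ => (flipRow p.1 k (lo + hi), p.2)) ?_ ?_ hS ?_
  · intro p hp
    obtain ⟨h1, h2, h3, h4⟩ := h p hp
    have hc := card_flipRow h1 h2 h3 h4
    obtain h5 | h5 := Nat.even_or_odd p.1.card
    · have h6 : Odd (flipRow p.1 k (lo + hi)).card := by
        rw [Nat.odd_iff]; rw [Nat.even_iff] at h5; omega
      rw [h5.neg_one_pow, h6.neg_one_pow]; norm_num
    · have h6 : Even (flipRow p.1 k (lo + hi)).card := by
        rw [Nat.even_iff]; rw [Nat.odd_iff] at h5; omega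
      rw [h5.neg_one_pow, h6.neg_one_pow]; norm_num
  · intro p hp _ heq
    obtain ⟨h1, h2, h3, h4⟩ := h p hp
    have hc := card_flipRow h1 h2 h3 h4
    have heq' : flipRow p.1 k (lo + hi) = p.1 := congrArg Prod.fst heq
    rw [heq'] at hc
    omega
  · intro p hp
    obtain ⟨h1, h2, h3, h4⟩ := h p hp
    refine Prod.ext ?_ rfl
    refine diagram_eq fun i => ?_
    rw [Function.update_apply]
    have h5 := rowLen_flipRow h1 h2 h3 h4
    split_ifs with h6
    · rw [h5, if_pos rfl, h6]; omega
    · rw [h5, if_neg h6]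

/-- In a chain μ ≺ ν ≺ ρ with ρ a block shape, the even-indexed rows of ν are forced to equal those
of ρ, while row `2k + 1` of ν moves freely between `μ_{2k+1}` and `μ_{2k}`. That row is flipped. -/
theorem sum_blocksAbove_eq_zero {μ : YoungDiagram} {k : ℕ}
    (hk : (μ.rowLen (2 * k + 1) + μ.rowLen (2 * k)) % 2 = 1) (n : ℕ) :
    ∑ p ∈ blocksAbove μ n, (-1 : ℚ) ^ p.1.card = 0 := by
  have h0 : ∀ p ∈ blocksAbove μ n, _ := fun p hp =>
    isBlock_above_iff.mp (mem_blocksAbove.mp hp).1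
  have h1 : ∀ p ∈ blocksAbove μ n, μ.rowLen (2 * k + 1) ≤ p.1.rowLen (2 * k + 1) ∧
      p.1.rowLen (2 * k + 1) ≤ μ.rowLen (2 * k) ∧
      p.1.rowLen (2 * k + 1 + 1) ≤ μ.rowLen (2 * k + 1) ∧
      ∀ j, j + 1 = 2 * k + 1 → μ.rowLen (2 * k) ≤ p.1.rowLen j := by
    intro p hp
    have h2 := h0 p hp k
    have h3 := h0 p hp (k + 1)
    rw [show 2 * (k + 1) = 2 * k + 2 by ring] at h3
    refine ⟨by omega, by omega, show p.1.rowLen (2 * k + 2) ≤ _ by omega, fun j hj => ?_⟩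
    obtain rfl : j = 2 * k := by omega
    omega
  refine sum_sign_eq_zero hk h1 fun p hp => ?_
  obtain ⟨h2, h3, h4, h5⟩ := h1 p hp
  have h6 := rowLen_flipRow h2 h3 h4 h5
  refine mem_blocksAbove.mpr ⟨isBlock_above_iff.mpr fun m => ?_, (mem_blocksAbove.mp hp).2⟩
  have h7 := h0 p hp m
  simp only [h6]
  rw [if_neg (by omega)]
  split_ifs with h8
  · obtain rfl : m = k := by omega
    omega
  · exact h7

/-- In a chain ρ ≺ ν ≺ μ the roles are exchanged: the odd-indexed rows of ν are forced, and row `2k`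
moves freely between `μ_{2k+1}` and `μ_{2k}`. The flip leaves ρ alone, hence respects any condition
`P` on its size. -/
theorem sum_blocksBelow_eq_zero {μ : YoungDiagram} {k : ℕ}
    (hk : (μ.rowLen (2 * k + 1) + μ.rowLen (2 * k)) % 2 = 1) (P : ℕ → Prop) [DecidablePred P] :
    ∑ p ∈ blocksBelow μ with P p.2.card, (-1 : ℚ) ^ p.1.card = 0 := by
  have h0 : ∀ p ∈ {p ∈ blocksBelow μ | P p.2.card}, _ := fun p hp =>
    isBlock_below_iff.mp (mem_blocksBelow.mp (Finset.mem_filter.mp hp).1)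
  have h1 : ∀ p ∈ {p ∈ blocksBelow μ | P p.2.card}, μ.rowLen (2 * k + 1) ≤ p.1.rowLen (2 * k) ∧
      p.1.rowLen (2 * k) ≤ μ.rowLen (2 * k) ∧
      p.1.rowLen (2 * k + 1) ≤ μ.rowLen (2 * k + 1) ∧
      ∀ j, j + 1 = 2 * k → μ.rowLen (2 * k) ≤ p.1.rowLen j := by
    intro p hp
    have h2 := h0 p hp k
    refine ⟨by omega, by omega, by omega, fun j hj => ?_⟩
    obtain ⟨m, rfl⟩ : ∃ m, k = m + 1 := ⟨k - 1, by omega⟩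
    obtain rfl : j = 2 * m + 1 := by omega
    have h3 := h0 p hp m
    rw [show 2 * (m + 1) = 2 * m + 2 by ring]
    omega
  refine sum_sign_eq_zero hk h1 fun p hp => ?_
  obtain ⟨h2, h3, h4, h5⟩ := h1 p hp
  have h6 := rowLen_flipRow h2 h3 h4 h5
  refine Finset.mem_filter.mpr ⟨mem_blocksBelow.mpr (isBlock_below_iff.mpr fun m => ?_),
    (Finset.mem_filter.mp hp).2⟩
  have h7 := h0 p hp m
  simp only [h6]
  rw [if_neg (c := 2 * m + 1 = 2 * k) (by omega)]
  split_ifs with h8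
  · obtain rfl : m = k := by omega
    omega
  · exact h7

/-! #### The bijection -/

/-- The sum of the end points of the even part of the interval
`[μ.rowLen (2 * k + 2), μ.rowLen (2 * k + 1)]`. -/
def evenEnds (μ : YoungDiagram) (k : ℕ) : ℕ :=
  2 * ((μ.rowLen (2 * k + 2) + 1) / 2) + 2 * (μ.rowLen (2 * k + 1) / 2)

/-- Summing the reflections, the ends of the intervals regroup into the row pairs of `μ`. Equal
parity of `μ_{2k}` and `μ_{2k+1}` makes rounding one up and the other down cancel. The top row of
`ρ` is in no interval and remains as a free term. -/
theorem card_add_card_of_evenEnds {μ ρ σ : YoungDiagram}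
    (hμ : ∀ k, (μ.rowLen (2 * k + 1) + μ.rowLen (2 * k)) % 2 = 0)
    (hρ : IsBlock ρ) (hσ : IsBlock σ)
    (h : ∀ k, ρ.rowLen (2 * k + 2) + σ.rowLen (2 * k) = evenEnds μ k) :
    ρ.card + σ.card + 4 * ((μ.rowLen 0 + 1) / 2) = 2 * μ.card + 2 * ρ.rowLen 0 := by
  obtain ⟨K, h1, h2, h3⟩ : ∃ K, ρ.card ≤ K ∧ σ.card ≤ K ∧ μ.card ≤ K :=
    ⟨ρ.card + σ.card + μ.card, by omega, by omega, by omega⟩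
  have e1 : ρ.card = ∑ k ∈ Finset.range K, 2 * ρ.rowLen (2 * k + 2) + 2 * ρ.rowLen 0 := by
    rw [card_eq_sum_pairs (h1.trans K.le_succ), Finset.sum_range_succ', (hρ 0).2, mul_zero,
      two_mul (ρ.rowLen 0)]
    congr 1
    refine Finset.sum_congr rfl fun k _ => ?_
    rw [(hρ (k + 1)).2, ← two_mul]
    rfl
  have e2 : σ.card = ∑ k ∈ Finset.range K, 2 * σ.rowLen (2 * k) := by
    rw [card_eq_sum_pairs h2]
    exact Finset.sum_congr rfl fun k _ => by rw [(hσ k).2, ← two_mul]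
  have e3 : ∑ k ∈ Finset.range K, 4 * ((μ.rowLen (2 * k + 2) + 1) / 2)
      + 4 * ((μ.rowLen 0 + 1) / 2) = ∑ k ∈ Finset.range K, 4 * ((μ.rowLen (2 * k) + 1) / 2) := by
    have := Finset.sum_range_succ' (fun k => 4 * ((μ.rowLen (2 * k) + 1) / 2)) K
    rw [Finset.sum_range_succ, rowLen_eq_zero (i := 2 * K) (by omega)] at this
    simpa [mul_add] using this.symm
  have e4 : ∑ k ∈ Finset.range K, 4 * ((μ.rowLen (2 * k) + 1) / 2)
      + ∑ k ∈ Finset.range K, 4 * (μ.rowLen (2 * k + 1) / 2) = 2 * μ.card := by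
    rw [card_eq_sum_pairs h3, ← Finset.sum_add_distrib, Finset.mul_sum]
    refine Finset.sum_congr rfl fun k _ => ?_
    have := hμ k
    omega
  have e5 : ∑ k ∈ Finset.range K, 2 * ρ.rowLen (2 * k + 2)
      + ∑ k ∈ Finset.range K, 2 * σ.rowLen (2 * k)
      = ∑ k ∈ Finset.range K, 4 * ((μ.rowLen (2 * k + 2) + 1) / 2)
        + ∑ k ∈ Finset.range K, 4 * (μ.rowLen (2 * k + 1) / 2) := by
    rw [← Finset.sum_add_distrib, ← Finset.sum_add_distrib]
    refine Finset.sum_congr rfl fun k _ => ?_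
    have := h k
    simp only [evenEnds] at this
    omega
  omega

/-- The forced rows of both middle shapes have even length, so only the free rows, which the
bijection copies, affect the sign. -/
theorem neg_one_pow_card_eq {ν ν' ρ ρ' : YoungDiagram} (hρ : IsBlock ρ) (hρ' : IsBlock ρ')
    (h1 : ∀ k, ν.rowLen (2 * k) = ρ.rowLen (2 * k))
    (h2 : ∀ k, ν'.rowLen (2 * k) = ν.rowLen (2 * k + 1))
    (h3 : ∀ k, ν'.rowLen (2 * k + 1) = ρ'.rowLen (2 * k)) :
    (-1 : ℚ) ^ ν.card = (-1) ^ ν'.card := by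
  obtain ⟨K, h4, h5⟩ : ∃ K, ν.card ≤ K ∧ ν'.card ≤ K :=
    ⟨ν.card + ν'.card, by omega, by omega⟩
  rw [card_eq_sum_pairs h4, card_eq_sum_pairs h5, ← Finset.prod_pow_eq_pow_sum, ← Finset.prod_pow_eq_pow_sum]
  refine Finset.prod_congr rfl fun k _ => ?_
  rw [pow_add, pow_add, h1, h2, h3, (hρ k).1.neg_one_pow, (hρ' k).1.neg_one_pow, one_mul, mul_one]

/-- Row `2k + 2` of the upper block shape and row `2k` of the lower one are both even numbers in
`[μ_{2k+2}, μ_{2k+1}]`; the bijection reflects this even part and copies the free rows of ν. The top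
row `ρ_0` above is any even number at least `μ_0`, and `n + |σ| - 2|μ| = 4 (ρ_0 / 2 - ⌈μ_0 / 2⌉)`
for the lower shape σ; this is the source of the multiples of 4. -/
theorem sum_blocksAbove_of_even {μ : YoungDiagram}
    (hμ : ∀ k, (μ.rowLen (2 * k + 1) + μ.rowLen (2 * k)) % 2 = 0) (n : ℕ) :
    ∑ p ∈ blocksAbove μ n, (-1 : ℚ) ^ p.1.card
      = ∑ p ∈ blocksBelow μ with 2 * μ.card ≤ n + p.2.card ∧
          4 ∣ n + p.2.card - 2 * μ.card, (-1 : ℚ) ^ p.1.card := by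
  -- `c` and `d` are the row pairs of the new block shapes. The value of `d` at 0 is the top row
  -- recovered from the size `n` by solving `card_add_card_of_evenEnds` for it.
  let c : YoungDiagram → ℕ → ℕ := fun ρ k => evenEnds μ k - ρ.rowLen (2 * k + 2)
  let d : YoungDiagram → ℕ → ℕ := fun σ k => Nat.casesOn k
    ((n + σ.card - 2 * μ.card) / 2 + 2 * ((μ.rowLen 0 + 1) / 2))
    (fun k => evenEnds μ k - σ.rowLen (2 * k))
  have d0 : ∀ σ, d σ 0 = (n + σ.card - 2 * μ.card) / 2 + 2 * ((μ.rowLen 0 + 1) / 2) :=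
    fun _ => rfl
  have dS : ∀ σ k, d σ (k + 1) = evenEnds μ k - σ.rowLen (2 * k) := fun _ _ => rfl
  have hμ0 : μ.rowLen (2 * μ.card + 1) = 0 := rowLen_eq_zero (by omega)
  have hμ1 : μ.rowLen (2 * μ.card + 2) = 0 := rowLen_eq_zero (by omega)
  have hμ2 : μ.rowLen (2 * μ.card) = 0 := rowLen_eq_zero (by omega)
  have A0 : ∀ p ∈ blocksAbove μ n, _ := fun p hp =>
    isBlock_above_iff.mp (mem_blocksAbove.mp hp).1
  have A1 : ∀ p ∈ blocksAbove μ n, ∀ k,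
      (diagram (interleave (c p.2) (c p.2))).rowLen (2 * k) = c p.2 k ∧
        (diagram (interleave (c p.2) (c p.2))).rowLen (2 * k + 1) = c p.2 k := by
    refine fun p hp => rowLen_diagram_interleave (K := μ.card) (fun k => le_rfl) (fun k => ?_) ?_
    · have h1 := A0 p hp k; have h2 := A0 p hp (k + 1); have h3 := A0 p hp (k + 2)
      have := rowLen_antitone μ (show 2 * k + 2 ≤ 2 * k + 3 by omega)
      simp only [c, evenEnds, mul_add, mul_one, add_assoc, Nat.reduceAdd, Nat.reduceMul] at *
      omega
    · have := A0 p hp μ.card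
      simp only [c, evenEnds]
      omega
  have A2 : ∀ p ∈ blocksAbove μ n, ∀ k,
      (diagram (interleave (fun k => p.1.rowLen (2 * k + 1)) (c p.2))).rowLen (2 * k)
          = p.1.rowLen (2 * k + 1) ∧
        (diagram (interleave (fun k => p.1.rowLen (2 * k + 1)) (c p.2))).rowLen (2 * k + 1)
          = c p.2 k := by
    refine fun p hp => rowLen_diagram_interleave (K := μ.card) (fun k => ?_) (fun k => ?_) ?_
    · have h1 := A0 p hp k; have h2 := A0 p hp (k + 1)
      simp only [c, evenEnds, mul_add, mul_one, add_assoc, Nat.reduceAdd] at *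
      omega
    · have h1 := A0 p hp k; have h2 := A0 p hp (k + 1)
      simp only [c, evenEnds, mul_add, mul_one, add_assoc, Nat.reduceAdd] at *
      omega
    · have := A0 p hp μ.card
      omega
  have A3 : ∀ p ∈ blocksAbove μ n, IsBlock (diagram (interleave (c p.2) (c p.2))) := by
    intro p hp k
    rw [(A1 p hp k).1, (A1 p hp k).2]
    refine ⟨?_, rfl⟩
    have h1 := A0 p hp (k + 1)
    rw [Nat.even_iff]
    simp only [c, evenEnds, mul_add, mul_one] at *
    omega
  have A4 : ∀ p ∈ blocksAbove μ n, 
      p.2.card + (diagram (interleave (c p.2) (c p.2))).card + 4 * ((μ.rowLen 0 + 1) / 2)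
        = 2 * μ.card + 2 * p.2.rowLen 0 := by
    intro p hp
    refine card_add_card_of_evenEnds hμ (mem_blocksAbove.mp hp).1.1 (A3 p hp) fun k => ?_
    rw [(A1 p hp k).1]
    have h1 := A0 p hp k; have h2 := A0 p hp (k + 1)
    simp only [c, evenEnds, mul_add, mul_one, add_assoc, Nat.reduceAdd] at *
    omega
  set S := {p ∈ blocksBelow μ | 2 * μ.card ≤ n + p.2.card ∧ 4 ∣ n + p.2.card - 2 * μ.card}
    with hS
  have B0 : ∀ p ∈ S, _ := fun p hp =>
    isBlock_below_iff.mp (mem_blocksBelow.mp (Finset.mem_filter.mp hp).1)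
  have B1 : ∀ p ∈ S, ∀ k,
      (diagram (interleave (d p.2) (d p.2))).rowLen (2 * k) = d p.2 k ∧
        (diagram (interleave (d p.2) (d p.2))).rowLen (2 * k + 1) = d p.2 k := by
    refine fun p hp => rowLen_diagram_interleave (K := μ.card + 1) (fun k => le_rfl)
      (fun k => ?_) ?_
    · rcases k with _ | k
      · have := B0 p hp 0
        have := rowLen_antitone μ (show 0 ≤ 1 by omega)
        simp only [dS, d0, evenEnds, mul_zero, zero_add] at *
        omega
      · have h1 := B0 p hp k; have h2 := B0 p hp (k + 1)
        have := rowLen_antitone μ (show 2 * k + 2 ≤ 2 * k + 3 by omega)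
        simp only [dS, evenEnds, mul_add, mul_one, add_assoc, Nat.reduceAdd] at *
        omega
    · have := B0 p hp μ.card
      simp only [dS, evenEnds]
      omega
  have B2 : ∀ p ∈ S, ∀ k,
      (diagram (interleave (d p.2) (fun k => p.1.rowLen (2 * k)))).rowLen (2 * k)
          = d p.2 k ∧
        (diagram (interleave (d p.2) (fun k => p.1.rowLen (2 * k)))).rowLen (2 * k + 1)
          = p.1.rowLen (2 * k) := by
    refine fun p hp => rowLen_diagram_interleave (K := μ.card + 1) (fun k => ?_) (fun k => ?_) ?_
    · rcases k with _ | k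
      · have := B0 p hp 0
        simp only [d0, mul_zero, zero_add] at *
        omega
      · have h1 := B0 p hp k; have h2 := B0 p hp (k + 1)
        simp only [dS, evenEnds, mul_add, mul_one, add_assoc, Nat.reduceAdd] at *
        omega
    · have := B0 p hp k
      simp only [dS, evenEnds]
      omega
    · have := B0 p hp μ.card
      simp only [dS, evenEnds]
      omega
  have B3 : ∀ p ∈ S, IsBlock (diagram (interleave (d p.2) (d p.2))) := by
    intro p hp k
    rw [(B1 p hp k).1, (B1 p hp k).2]
    refine ⟨?_, rfl⟩
    rw [Nat.even_iff]
    rcases k with _ | k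
    · have := (Finset.mem_filter.mp hp).2
      rw [d0]
      omega
    · have := B0 p hp k
      simp only [dS, evenEnds]
      omega
  have B4 : ∀ p ∈ S,
      (diagram (interleave (d p.2) (d p.2))).card + p.2.card + 4 * ((μ.rowLen 0 + 1) / 2)
        = 2 * μ.card + 2 * d p.2 0 := by
    intro p hp
    rw [← (B1 p hp 0).1, mul_zero]
    refine card_add_card_of_evenEnds hμ (B3 p hp)
      (mem_blocksBelow.mp (Finset.mem_filter.mp hp).1).1 fun k => ?_
    rw [show 2 * k + 2 = 2 * (k + 1) by ring, (B1 p hp (k + 1)).1, dS]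
    have := B0 p hp k
    simp only [evenEnds]
    omega
  refine Finset.sum_nbij'
    (fun p => (diagram (interleave (fun k => p.1.rowLen (2 * k + 1)) (c p.2)),
      diagram (interleave (c p.2) (c p.2))))
    (fun p => (diagram (interleave (d p.2) (fun k => p.1.rowLen (2 * k))),
      diagram (interleave (d p.2) (d p.2)))) ?_ ?_ ?_ ?_ ?_
  · intro p hp
    have hn := (mem_blocksAbove.mp hp).2
    have h3 := A4 p hp
    have h4 := A0 p hp 0
    rw [hS, Finset.mem_filter, mem_blocksBelow, isBlock_below_iff]
    refine ⟨fun k => ?_, ?_⟩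
    · simp only [A1 p hp, A2 p hp, true_and]
      have h1 := A0 p hp k; have h2 := A0 p hp (k + 1)
      simp only [c, evenEnds, mul_add, mul_one, add_assoc, Nat.reduceAdd] at *
      omega
    · simp only [mul_zero] at h4 ⊢
      omega
  · intro p hp
    have hn := (Finset.mem_filter.mp hp).2
    have h3 := B4 p hp
    rw [mem_blocksAbove, isBlock_above_iff]
    refine ⟨fun k => ?_, ?_⟩
    · rw [show 2 * k + 2 = 2 * (k + 1) by ring]
      simp only [B1 p hp, B2 p hp, true_and]
      have h1 := B0 p hp k
      have h5 := B3 p hp k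
      rw [Nat.even_iff, (B1 p hp k).1] at h5
      refine ⟨h5.1, ?_, ?_, ?_, ?_⟩
      · rcases k with _ | k
        · simp only [d0, mul_zero] at *
          omega
        · have h2 := B0 p hp k
          simp only [dS, evenEnds, mul_add, mul_one, add_assoc, Nat.reduceAdd] at *
          omega
      · simp only [dS, evenEnds]
        omega
      · omega
      · omega
    · rw [d0] at h3
      simp only
      omega
  · intro p hp
    have hn := (mem_blocksAbove.mp hp).2
    have h3 := A4 p hp
    have h4 : ∀ k, d (diagram (interleave (c p.2) (c p.2))) k = p.2.rowLen (2 * k) := by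
      intro k
      have h1 := A0 p hp k
      rcases k with _ | k
      · simp only [d0, mul_zero] at *
        omega
      · rw [dS, (A1 p hp k).1]
        have h2 := A0 p hp k
        simp only [c, evenEnds, mul_add, mul_one, add_assoc, Nat.reduceAdd] at *
        omega
    refine Prod.ext (diagram_interleave_eq fun k => ⟨?_, ?_⟩)
      (diagram_interleave_eq fun k => ⟨h4 k, ?_⟩)
    · rw [h4, (A0 p hp k).2.2.1]
    · exact (A2 p hp k).1
    · rw [h4, (A0 p hp k).2.1]
  · intro p hp
    have h4 : ∀ k, c (diagram (interleave (d p.2) (d p.2))) k = p.2.rowLen (2 * k) := by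
      intro k
      have h1 := B0 p hp k
      simp only [c]
      rw [show 2 * k + 2 = 2 * (k + 1) by ring, (B1 p hp (k + 1)).1, dS]
      simp only [evenEnds]
      omega
    refine Prod.ext (diagram_interleave_eq fun k => ⟨?_, ?_⟩)
      (diagram_interleave_eq fun k => ⟨h4 k, ?_⟩)
    · exact (B2 p hp k).2
    · rw [h4, (B0 p hp k).2.2.1]
    · rw [h4, (B0 p hp k).2.1]
  · intro p hp
    refine neg_one_pow_card_eq (mem_blocksAbove.mp hp).1.1 (A3 p hp)
      (fun k => (A0 p hp k).2.2.1) (fun k => (A2 p hp k).1) fun k => ?_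
    rw [(A2 p hp k).2, (A1 p hp k).1]

theorem sum_blocksAbove (μ : YoungDiagram) (n : ℕ) :
    ∑ p ∈ blocksAbove μ n, (-1 : ℚ) ^ p.1.card
      = ∑ p ∈ blocksBelow μ with 2 * μ.card ≤ n + p.2.card ∧
          4 ∣ n + p.2.card - 2 * μ.card, (-1 : ℚ) ^ p.1.card := by
  by_cases h : ∀ k, (μ.rowLen (2 * k + 1) + μ.rowLen (2 * k)) % 2 = 0
  · exact sum_blocksAbove_of_even h n
  · push Not at h
    obtain ⟨k, hk⟩ := h
    rw [sum_blocksAbove_eq_zero (k := k) (by omega),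
      sum_blocksBelow_eq_zero (k := k) (by omega)
        (fun m => 2 * μ.card ≤ n + m ∧ 4 ∣ n + m - 2 * μ.card)]

/-! ### Adjoining a pair of opposite numbers -/

open Classical in
/-- The sum of the values at `l` of the Schur functions of block shapes, graded by size. -/
noncomputable def blockSeries (l : List ℚ) : PowerSeries ℚ :=
  PowerSeries.mk fun n => ∑ ρ ∈ upTo n with IsBlock ρ ∧ ρ.card = n, schurEval l ρ

/-- The series `∑ t^j h_j(l) X^(2j)`. -/
noncomputable def hSeries (t : ℚ) (l : List ℚ) : PowerSeries ℚ :=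
  PowerSeries.mk fun m => if Even m then t ^ (m / 2) * hEval l (m / 2) else 0

theorem hEval_zero (l : List ℚ) : hEval l 0 = 1 := by
  induction l with
  | nil => simp [hEval]
  | cons x l ih => simp [hEval, ih]

theorem hEval_cons_succ (x : ℚ) (l : List ℚ) (n : ℕ) :
    hEval (x :: l) (n + 1) = x * hEval (x :: l) n + hEval l (n + 1) := by
  rw [hEval, Finset.sum_range_succ, Nat.sub_self, pow_zero, one_mul, hEval, Finset.mul_sum]
  congr 1
  refine Finset.sum_congr rfl fun k hk => ?_
  rw [Finset.mem_range] at hk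
  rw [show n + 1 - k = n - k + 1 by omega, pow_succ]
  ring

theorem hSeries_nil (t : ℚ) : hSeries t [] = 1 := by
  ext m
  rw [hSeries, PowerSeries.coeff_mk, PowerSeries.coeff_one]
  rcases m with _ | m
  · simp [hEval]
  · rw [if_neg (Nat.succ_ne_zero m)]
    split_ifs with h1
    · rw [hEval, if_neg (by obtain ⟨k, hk⟩ := h1; omega), mul_zero]
    · rfl

theorem coeff_mul_one_sub (A : PowerSeries ℚ) (a : ℚ) (d m : ℕ) :
    PowerSeries.coeff m (A * (1 - PowerSeries.C a * PowerSeries.X ^ d))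
      = PowerSeries.coeff m A - if d ≤ m then a * PowerSeries.coeff (m - d) A else 0 := by
  rw [mul_sub, mul_one, map_sub, mul_left_comm, PowerSeries.coeff_C_mul,
    PowerSeries.coeff_mul_X_pow']
  split_ifs <;> simp

theorem hSeries_cons (t x : ℚ) (l : List ℚ) :
    hSeries t (x :: l) * (1 - PowerSeries.C (t * x) * PowerSeries.X ^ 2) = hSeries t l := by
  ext m
  rw [coeff_mul_one_sub]
  simp only [hSeries, PowerSeries.coeff_mk]
  obtain ⟨k, hk⟩ | hm := Nat.even_or_odd m
  · rcases k with _ | k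
    · subst hk; simp [hEval_zero]
    · rw [if_pos (by use k + 1), if_pos (by omega), if_pos (by use k; omega),
        if_pos (by use k + 1), show m / 2 = k + 1 by omega, show (m - 2) / 2 = k by omega,
        hEval_cons_succ]
      ring
  · have h1 : ¬ Even m := Nat.not_even_iff_odd.mpr hm
    rw [if_neg h1, if_neg h1]
    split_ifs with h2 h3
    · exact absurd ((Nat.even_sub h2).mp h3 |>.mpr even_two) h1
    · simp
    · simp

/-- H(t)H(-t) is the product of 1/((1 - txX²)(1 + txX²)) over the entries, so it inverts the product
over `l` in the pair identity. The variable `X` has exponent `2j` at `h_j` because both `t` and the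
entries have degree 1. -/
theorem hSeries_mul_hSeries_neg (t : ℚ) (l : List ℚ) :
    hSeries t l * hSeries (-t) l *
      (l.map fun x => 1 - PowerSeries.C (t ^ 2 * x ^ 2) * PowerSeries.X ^ 4).prod = 1 := by
  induction l with
  | nil => simp [hSeries_nil]
  | cons x l ih =>
    rw [← hSeries_cons t x, ← hSeries_cons (-t) x] at ih
    rw [List.map_cons, List.prod_cons]
    have : (1 : PowerSeries ℚ) - PowerSeries.C (t ^ 2 * x ^ 2) * PowerSeries.X ^ 4
        = (1 - PowerSeries.C (t * x) * PowerSeries.X ^ 2)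
          * (1 - PowerSeries.C (-t * x) * PowerSeries.X ^ 2) := by
      simp only [map_mul, map_pow, map_neg]
      ring
    rw [this]
    linear_combination ih

theorem coeff_mul_hSeries (A : PowerSeries ℚ) (t : ℚ) (l : List ℚ) (m : ℕ) :
    PowerSeries.coeff m (A * hSeries t l) = ∑ j ∈ Finset.range (m + 1),
      if 2 * j ≤ m then PowerSeries.coeff (m - 2 * j) A * (t ^ j * hEval l j) else 0 := by
  rw [mul_comm, PowerSeries.coeff_mul, Finset.Nat.sum_antidiagonal_eq_sum_range_succ_mk,
    ← Finset.sum_filter]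
  simp only [hSeries, PowerSeries.coeff_mk, ite_mul, zero_mul]
  rw [← Finset.sum_filter]
  refine Finset.sum_nbij' (fun a => a / 2) (fun j => 2 * j) ?_ ?_ ?_ ?_ ?_
  · intro a ha
    simp only [Finset.mem_filter, Finset.mem_range] at ha ⊢
    omega
  · intro j hj
    simp only [Finset.mem_filter, Finset.mem_range] at hj ⊢
    exact ⟨by omega, even_two_mul j⟩
  · intro a ha
    have := Nat.even_iff.mp (Finset.mem_filter.mp ha).2
    omega
  · intro j _
    omega
  · intro a ha
    have := Nat.even_iff.mp (Finset.mem_filter.mp ha).2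
    rw [show 2 * (a / 2) = a by omega, mul_comm]

open Classical in
/-- Multiplication by `∑ t^j h_j X^(2j)` in terms of coefficients with respect to Schur functions:
the graded Pieri rule. -/
theorem coeff_mul_hSeries_of_schur {A : PowerSeries ℚ} {l : List ℚ}
    {v : ℕ → YoungDiagram → ℚ} (hv : ∀ m ν, m < ν.card → v m ν = 0)
    (hA : ∀ m, PowerSeries.coeff m A = ∑ ν ∈ upTo m, v m ν * schurEval l ν) (t : ℚ) (m : ℕ) :
    PowerSeries.coeff m (A * hSeries t l) = ∑ μ ∈ upTo m,
      (∑ ν ∈ below μ, if 2 * (μ.card - ν.card) ≤ m then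
        t ^ (μ.card - ν.card) * v (m - 2 * (μ.card - ν.card)) ν else 0) * schurEval l μ := by
  have h1 : ∀ j ∈ Finset.range (m + 1),
      (if 2 * j ≤ m then PowerSeries.coeff (m - 2 * j) A * (t ^ j * hEval l j) else 0)
      = ∑ ν ∈ upTo m, ∑ μ ∈ upTo m, if HStrip ν μ ∧ μ.card = ν.card + j then
          (if 2 * j ≤ m then t ^ j * v (m - 2 * j) ν * schurEval l μ else 0) else 0 := by
    intro j _
    split_ifs with hj
    · have hsub : upTo (m - 2 * j) ⊆ upTo m := fun ν hν => by
        rw [mem_upTo] at *; omega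
      -- Shapes too large for the smaller degree have coefficient zero by `hv`, so all inner sums
      -- may range over the same set and be interchanged.
      rw [hA, Finset.sum_subset hsub fun ν _ h => by
        rw [mem_upTo] at h; rw [hv _ _ (by omega), zero_mul], Finset.sum_mul]
      refine Finset.sum_congr rfl fun ν _ => ?_
      by_cases hν : m - 2 * j < ν.card
      · simp [hv _ _ hν]
      · have h2 : ({μ ∈ upTo m | HStrip ν μ ∧ μ.card = ν.card + j} : Finset _)
            = above ν (ν.card + j) := by
          ext μ
          simp only [Finset.mem_filter, mem_upTo, mem_above, and_iff_right_iff_imp]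
          omega
        rw [← Finset.sum_filter, h2, ← Finset.mul_sum, sum_above_schurEval]
        ring
    · simp
  rw [coeff_mul_hSeries, Finset.sum_congr rfl h1, Finset.sum_comm,
    Finset.sum_congr rfl fun _ _ => Finset.sum_comm, Finset.sum_comm]
  refine Finset.sum_congr rfl fun μ hμ => ?_
  rw [mem_upTo] at hμ
  have h3 : below μ = {ν ∈ upTo m | HStrip ν μ} := by
    ext ν
    simp only [mem_below, Finset.mem_filter, mem_upTo, iff_and_self]
    exact fun h => h.card_le.trans hμ
  rw [h3, Finset.sum_filter, Finset.sum_mul]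
  refine Finset.sum_congr rfl fun ν _ => ?_
  by_cases hs : HStrip ν μ
  · have hc := hs.card_le
    rw [Finset.sum_eq_single (μ.card - ν.card)]
    · rw [if_pos ⟨hs, by omega⟩, if_pos hs, ite_mul, zero_mul]
    · intro j _ hj
      rw [if_neg fun h => hj (by omega)]
    · intro h
      simp only [Finset.mem_range] at h
      omega
  · simp [hs]

/-! ### The two sides of the pair identity as signed sums over chains -/

-- The Pieri rule is used for `t` and then for `-t`. A chain ρ ≺ ν ≺ μ has degree `|ρ| + 2(|μ| -
-- |ρ|) = m`, which is the size condition, and the power of `t` is `|μ| - |ρ| = m - |μ|`.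
open Classical in
theorem coeff_blockSeries_mul_hSeries (t : ℚ) (l : List ℚ) (m : ℕ) :
    PowerSeries.coeff m (blockSeries l * hSeries t l * hSeries (-t) l)
      = ∑ μ ∈ upTo m, (-1) ^ μ.card * t ^ (m - μ.card) * schurEval l μ *
        ∑ p ∈ blocksBelow μ with 2 * μ.card = m + p.2.card, (-1) ^ p.1.card := by
  have h0 := coeff_mul_hSeries_of_schur (A := blockSeries l) (l := l)
    (v := fun m ν => if IsBlock ν ∧ ν.card = m then 1 else 0)
    (fun m ν h => if_neg (by omega)) (fun m => by
      rw [blockSeries, PowerSeries.coeff_mk, Finset.sum_filter]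
      exact Finset.sum_congr rfl fun ν _ => by split_ifs <;> simp) t
  rw [coeff_mul_hSeries_of_schur (fun m μ h => ?_) h0]
  · refine Finset.sum_congr rfl fun μ hμ => ?_
    rw [mem_upTo] at hμ
    rw [mul_right_comm]
    congr 1
    have h1 : ({p ∈ blocksBelow μ | 2 * μ.card = m + p.2.card} : Finset _)
        = {p ∈ (below μ) ×ˢ upTo μ.card | HStrip p.2 p.1 ∧ IsBlock p.2 ∧
            2 * μ.card = m + p.2.card} := by
      ext p
      simp only [Finset.mem_filter, mem_blocksBelow, Finset.mem_product, mem_below, mem_upTo]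
      constructor
      · rintro ⟨⟨h1, h2, h3⟩, h4⟩
        exact ⟨⟨h3, h2.card_le.trans h3.card_le⟩, h2, h1, h4⟩
      · rintro ⟨⟨h1, _⟩, h2, h3, h4⟩
        exact ⟨⟨h3, h2, h1⟩, h4⟩
    rw [h1, Finset.sum_filter, Finset.sum_product, Finset.mul_sum]
    refine Finset.sum_congr rfl fun ν hν => ?_
    have hν' := (mem_below.mp hν).card_le
    have h2 : below ν = {ρ ∈ upTo μ.card | HStrip ρ ν} := by
      ext ρ
      simp only [mem_below, Finset.mem_filter, mem_upTo, iff_and_self]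
      exact fun h => h.card_le.trans hν'
    rw [h2, Finset.sum_filter, Finset.mul_sum]
    by_cases h3 : 2 * (μ.card - ν.card) ≤ m
    · rw [if_pos h3, Finset.mul_sum]
      refine Finset.sum_congr rfl fun ρ _ => ?_
      dsimp only
      by_cases h4 : HStrip ρ ν
      · have hρ := h4.card_le
        rw [if_pos h4]
        by_cases h5 : IsBlock ρ ∧ 2 * μ.card = m + ρ.card
        · rw [if_pos (by omega), if_pos ⟨h5.1, by omega⟩, if_pos ⟨h4, h5⟩, neg_pow]
          -- The sign of `-t` is the parity of a strip size; it splits into a factor depending on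
          -- `μ` alone and the sign of the middle shape.
          have e1 : (-1 : ℚ) ^ (μ.card - ν.card) = (-1) ^ μ.card * (-1) ^ ν.card := by
            rw [← pow_add, show μ.card + ν.card = μ.card - ν.card + 2 * ν.card by omega, pow_add,
              pow_mul (-1 : ℚ) 2]
            simp
          have e2 : t ^ (m - μ.card) = t ^ (μ.card - ν.card) * t ^ (ν.card - ρ.card) := by
            rw [← pow_add]; congr 1; omega
          rw [e1, e2]
          ring
        · rw [if_neg fun h : HStrip ρ ν ∧ IsBlock ρ ∧ 2 * μ.card = m + ρ.card => h5 h.2, mul_zero]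
          split_ifs with h6 h7
          · exact absurd ⟨h7.1, by omega⟩ h5
          · simp
          · simp
      · simp [h4]
    · rw [if_neg h3]
      rw [Finset.sum_eq_zero, mul_zero]
      refine fun ρ _ => if_neg ?_
      rintro ⟨h4, _, h5⟩
      dsimp only at h4 h5
      have := h4.card_le
      omega
  · refine Finset.sum_eq_zero fun ν hν => ?_
    have := (mem_below.mp hν).card_le
    split_ifs
    · omega
    · simp
    · rfl

-- The branching rule is used for `t` and then for `-t`; the chains now lie above μ, and the
-- prefactor matches that of `coeff_blockSeries_mul_hSeries`, so only the signed chain sums remain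
-- to be compared.
open Classical in
theorem coeff_blockSeries_cons_cons_neg (t : ℚ) (l : List ℚ) (n : ℕ) :
    PowerSeries.coeff n (blockSeries (t :: -t :: l))
      = ∑ μ ∈ upTo n, (-1) ^ μ.card * t ^ (n - μ.card) * schurEval l μ *
        ∑ p ∈ blocksAbove μ n, (-1) ^ p.1.card := by
  rw [blockSeries, PowerSeries.coeff_mk, Finset.sum_filter]
  have h1 : ∀ ρ ∈ upTo n, (if IsBlock ρ ∧ ρ.card = n then schurEval (t :: -t :: l) ρ else 0)
      = ∑ ν ∈ upTo n, ∑ μ ∈ upTo n, if IsBlock ρ ∧ HStrip ν ρ ∧ HStrip μ ν ∧ ρ.card = n then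
        (-1) ^ μ.card * t ^ (n - μ.card) * schurEval l μ * (-1) ^ ν.card else 0 := by
    intro ρ hρ
    by_cases h : IsBlock ρ ∧ ρ.card = n
    · rw [if_pos h, schurEval, show below ρ = {ν ∈ upTo n | HStrip ν ρ} by
        rw [below, h.2], Finset.sum_filter]
      refine Finset.sum_congr rfl fun ν hν => ?_
      rw [mem_upTo] at hν
      by_cases hs : HStrip ν ρ
      · rw [if_pos hs, schurEval, show below ν = {μ ∈ upTo n | HStrip μ ν} by
          ext μ
          simp only [mem_below, Finset.mem_filter, mem_upTo, iff_and_self]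
          exact fun h => h.card_le.trans hν, Finset.sum_filter, Finset.mul_sum]
        refine Finset.sum_congr rfl fun μ _ => ?_
        by_cases hs' : HStrip μ ν
        · have hc := hs'.card_le
          rw [if_pos hs', if_pos ⟨h.1, hs, hs', h.2⟩, neg_pow, h.2]
          have e1 : (-1 : ℚ) ^ (ν.card - μ.card) = (-1) ^ μ.card * (-1) ^ ν.card := by
            rw [← pow_add, show μ.card + ν.card = ν.card - μ.card + 2 * μ.card by omega, pow_add,
              pow_mul (-1 : ℚ) 2]
            simp
          have e2 : t ^ (n - μ.card) = t ^ (n - ν.card) * t ^ (ν.card - μ.card) := by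
            rw [← pow_add]; congr 1; omega
          rw [e1, e2]
          ring
        · simp [hs']
      · simp [hs]
    · rw [if_neg h]
      symm
      refine Finset.sum_eq_zero fun ν _ => Finset.sum_eq_zero fun μ _ => if_neg ?_
      exact fun h' => h ⟨h'.1, h'.2.2.2⟩
  rw [Finset.sum_congr rfl h1, Finset.sum_comm, Finset.sum_congr rfl fun _ _ => Finset.sum_comm,
    Finset.sum_comm]
  refine Finset.sum_congr rfl fun μ _ => ?_
  rw [blocksAbove, Finset.sum_filter, Finset.sum_product, Finset.mul_sum]
  refine Finset.sum_congr rfl fun ν _ => ?_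
  rw [Finset.mul_sum]
  refine Finset.sum_congr rfl fun ρ _ => ?_
  simp only [and_assoc, mul_ite, mul_zero]

/-- By `sum_blocksAbove` the chains on the left are those with `n + |ρ| - 2|μ|` in {0, 4, 8, …}.
Multiplying by 1 - t⁴X⁴ subtracts the same sum with `n - 4` in place of `n` and leaves the value 0.
-/
theorem blockSeries_cons_cons_neg_mul (t : ℚ) (l : List ℚ) :
    blockSeries (t :: -t :: l) * (1 - PowerSeries.C (t ^ 4) * PowerSeries.X ^ 4)
      = blockSeries l * hSeries t l * hSeries (-t) l := by
  classical
  ext n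
  rw [coeff_mul_one_sub, coeff_blockSeries_mul_hSeries, coeff_blockSeries_cons_cons_neg]
  simp only [sum_blocksAbove]
  by_cases hn : 4 ≤ n
  · rw [if_pos hn, coeff_blockSeries_cons_cons_neg]
    simp only [sum_blocksAbove]
    have hsub : upTo (n - 4) ⊆ upTo n := fun ν hν => by
      rw [mem_upTo] at *; omega
    have h1 : ∑ μ ∈ upTo (n - 4), (-1) ^ μ.card * t ^ (n - 4 - μ.card) * schurEval l μ *
          ∑ p ∈ blocksBelow μ with 2 * μ.card ≤ n - 4 + p.2.card ∧
            4 ∣ n - 4 + p.2.card - 2 * μ.card, (-1 : ℚ) ^ p.1.card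
        = ∑ μ ∈ upTo n, (-1) ^ μ.card * t ^ (n - 4 - μ.card) * schurEval l μ *
          ∑ p ∈ blocksBelow μ with 2 * μ.card ≤ n - 4 + p.2.card ∧
            4 ∣ n - 4 + p.2.card - 2 * μ.card, (-1 : ℚ) ^ p.1.card := by
      refine Finset.sum_subset hsub fun μ _ hμ => ?_
      rw [mem_upTo] at hμ
      -- Since `|ρ| ≤ |μ|`, the condition `2|μ| ≤ n - 4 + |ρ|` forces `|μ| ≤ n - 4`, so the added
      -- terms are empty and the truncated exponent of `t` is harmless.
      rw [Finset.filter_false_of_mem, Finset.sum_empty, mul_zero]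
      intro p hp h
      have := (mem_blocksBelow.mp hp).2
      have := this.1.card_le.trans this.2.card_le
      omega
    rw [h1, Finset.mul_sum, ← Finset.sum_sub_distrib]
    refine Finset.sum_congr rfl fun μ hμ => ?_
    have h2 : ∑ p ∈ blocksBelow μ with 2 * μ.card ≤ n + p.2.card ∧
          4 ∣ n + p.2.card - 2 * μ.card, (-1 : ℚ) ^ p.1.card
        = ∑ p ∈ blocksBelow μ with 2 * μ.card = n + p.2.card, (-1 : ℚ) ^ p.1.card
          + ∑ p ∈ blocksBelow μ with 2 * μ.card ≤ n - 4 + p.2.card ∧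
            4 ∣ n - 4 + p.2.card - 2 * μ.card, (-1 : ℚ) ^ p.1.card := by
      rw [← Finset.sum_union]
      · refine Finset.sum_congr ?_ fun _ _ => rfl
        rw [← Finset.filter_or]
        refine Finset.filter_congr fun p _ => ?_
        omega
      · refine Finset.disjoint_filter.mpr fun p _ => ?_
        omega
    rw [h2]
    by_cases hμ' : μ.card ≤ n - 4
    · rw [show n - μ.card = 4 + (n - 4 - μ.card) by omega, pow_add]
      ring
    · have h3 : ∑ p ∈ blocksBelow μ with 2 * μ.card ≤ n - 4 + p.2.card ∧
            4 ∣ n - 4 + p.2.card - 2 * μ.card, (-1 : ℚ) ^ p.1.card = 0 := by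
        rw [Finset.filter_false_of_mem, Finset.sum_empty]
        intro p hp h
        have := (mem_blocksBelow.mp hp).2
        have := this.1.card_le.trans this.2.card_le
        omega
      rw [h3]
      ring
  · rw [if_neg hn, sub_zero]
    -- For `n < 4`, `|ρ| ≤ |μ|` gives `n + |ρ| - 2|μ| < 4`, so the only possible multiple of 4 is 0.
    refine Finset.sum_congr rfl fun μ _ => ?_
    congr 1
    refine Finset.sum_congr (Finset.filter_congr fun p hp => ?_) fun _ _ => rfl
    have := (mem_blocksBelow.mp hp).2
    have := this.1.card_le.trans this.2.card_le
    omega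

theorem blockSeries_cons_cons_neg (t : ℚ) (l : List ℚ) :
    blockSeries (t :: -t :: l) * ((1 - PowerSeries.C (t ^ 4) * PowerSeries.X ^ 4)
      * (l.map fun x => 1 - PowerSeries.C (t ^ 2 * x ^ 2) * PowerSeries.X ^ 4).prod)
      = blockSeries l := by
  rw [← mul_assoc, blockSeries_cons_cons_neg_mul, mul_assoc (blockSeries l), mul_assoc,
    hSeries_mul_hSeries_neg, mul_one]

/-! ### Logarithms of power series -/

/-- The chain rule, with 1/(1 + X) as derivative of log(1 + X). Multiplicativity, the explicit
logarithm of a binomial and the recursion for coefficients all rest on this differential equation.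
-/
theorem derivative_logOf_mul {f : PowerSeries ℚ} (hf : PowerSeries.constantCoeff f = 1) :
    PowerSeries.derivative ℚ (PowerSeries.logOf f) * f = PowerSeries.derivative ℚ f := by
  have hs : PowerSeries.HasSubst (f - 1) :=
    PowerSeries.HasSubst.of_constantCoeff_zero' (by simp [hf])
  have h1 : (PowerSeries.mk fun n => algebraMap ℚ ℚ ((-1 : ℚ) ^ n)) * (1 + PowerSeries.X) = 1 := by
    ext n
    rw [mul_add, mul_one, map_add]
    rcases n with _ | n
    · simp
    · rw [PowerSeries.coeff_succ_mul_X]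
      simp [PowerSeries.coeff_one, pow_succ]
  have h2 := congrArg (PowerSeries.substAlgHom hs) h1
  rw [map_mul, map_add, map_one, PowerSeries.substAlgHom_X, add_sub_cancel] at h2
  rw [PowerSeries.logOf_eq, PowerSeries.derivative_subst hs, PowerSeries.deriv_log, map_sub,
    ← PowerSeries.coe_substAlgHom hs, mul_right_comm, h2]
  simp

theorem logOf_mul {f g : PowerSeries ℚ} (hf : PowerSeries.constantCoeff f = 1)
    (hg : PowerSeries.constantCoeff g = 1) :
    PowerSeries.logOf (f * g) = PowerSeries.logOf f + PowerSeries.logOf g := by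
  have hfg : PowerSeries.constantCoeff (f * g) = 1 := by rw [map_mul, hf, hg, one_mul]
  refine PowerSeries.derivative.ext ?_ ?_
  · have h0 : f * g ≠ 0 := fun h => by simp [h] at hfg
    refine mul_right_cancel₀ h0 ?_
    rw [derivative_logOf_mul hfg, map_add, Derivation.leibniz, smul_eq_mul, smul_eq_mul,
      ← derivative_logOf_mul hf, ← derivative_logOf_mul hg]
    ring
  · rw [map_add, PowerSeries.constantCoeff_logOf hfg, PowerSeries.constantCoeff_logOf hf,
      PowerSeries.constantCoeff_logOf hg, add_zero]

theorem constantCoeff_list_prod {L : List (PowerSeries ℚ)}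
    (h : ∀ f ∈ L, PowerSeries.constantCoeff f = 1) : PowerSeries.constantCoeff L.prod = 1 := by
  rw [map_list_prod]
  exact List.prod_eq_one (by simpa using h)

theorem logOf_one : PowerSeries.logOf (1 : PowerSeries ℚ) = 0 := by
  have := logOf_mul (f := 1) (g := 1) (map_one _) (map_one _)
  rw [one_mul] at this
  simpa using this

theorem logOf_list_prod {L : List (PowerSeries ℚ)}
    (h : ∀ f ∈ L, PowerSeries.constantCoeff f = 1) :
    PowerSeries.logOf L.prod = (L.map PowerSeries.logOf).sum := by
  induction L with
  | nil => simp [logOf_one]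
  | cons f L ih =>
    rw [List.prod_cons, List.map_cons, List.sum_cons, logOf_mul (h f (by simp))
      (constantCoeff_list_prod fun g hg => h g (by simp [hg])), ih fun g hg => h g (by simp [hg])]

theorem constantCoeff_one_sub (c : ℚ) :
    PowerSeries.constantCoeff (1 - PowerSeries.C c * PowerSeries.X ^ 4 : PowerSeries ℚ) = 1 := by
  simp

theorem logOf_one_sub (c : ℚ) :
    PowerSeries.logOf (1 - PowerSeries.C c * PowerSeries.X ^ 4 : PowerSeries ℚ)
      = -PowerSeries.mk fun m => if 4 ∣ m ∧ m ≠ 0 then 4 * c ^ (m / 4) / (m : ℚ) else 0 := by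
  have hf := constantCoeff_one_sub c
  refine PowerSeries.derivative.ext ?_ ?_
  · have h0 : (1 - PowerSeries.C c * PowerSeries.X ^ 4 : PowerSeries ℚ) ≠ 0 :=
      fun h => by simp [h] at hf
    refine mul_right_cancel₀ h0 ?_
    rw [derivative_logOf_mul hf, map_neg, neg_mul, map_sub]
    ext m
    rw [map_neg, coeff_mul_one_sub]
    have e1 : ∀ k, PowerSeries.coeff k (PowerSeries.derivative ℚ (PowerSeries.mk fun m =>
        if 4 ∣ m ∧ m ≠ 0 then 4 * c ^ (m / 4) / (m : ℚ) else 0))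
        = if 4 ∣ k + 1 then 4 * c ^ ((k + 1) / 4) else 0 := by
      intro k
      rw [PowerSeries.coeff_derivative, PowerSeries.coeff_mk]
      by_cases hk : 4 ∣ k + 1
      · rw [if_pos ⟨hk, by omega⟩, if_pos hk]
        push_cast
        field_simp
      · rw [if_neg fun h => hk h.1, if_neg hk, zero_mul]
    rw [e1, e1, map_sub, PowerSeries.coeff_derivative, PowerSeries.coeff_derivative,
      PowerSeries.coeff_C_mul, PowerSeries.coeff_X_pow, PowerSeries.coeff_one,
      if_neg (Nat.succ_ne_zero m), zero_mul, zero_sub, neg_inj]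
    by_cases h4 : 4 ≤ m
    · rw [if_neg (by omega), if_pos h4, mul_zero, zero_mul]
      by_cases hm : 4 ∣ m + 1
      · rw [if_pos hm, if_pos (by omega), show (m + 1) / 4 = (m - 4 + 1) / 4 + 1 by omega, pow_succ]
        ring
      · rw [if_neg hm, if_neg (by omega)]
        ring
    · rw [if_neg h4, sub_zero]
      by_cases hm : m = 3
      · subst hm
        norm_num
        ring
      · rw [if_neg (by omega), if_neg (by omega)]
        ring
  · rw [PowerSeries.constantCoeff_logOf hf, map_neg,
      ← PowerSeries.coeff_zero_eq_constantCoeff_apply, PowerSeries.coeff_mk]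
    simp

/-! ### The invariance of the logarithm under adjoining opposite numbers -/

/-- The power sum of degree `k` of a list of numbers. -/
def psum (k : ℕ) (l : List ℚ) : ℚ := (l.map (· ^ k)).sum

theorem psum_nil (k : ℕ) : psum k [] = 0 := rfl

theorem psum_cons (k : ℕ) (x : ℚ) (l : List ℚ) : psum k (x :: l) = x ^ k + psum k l := by
  simp [psum]

/-- The series `∑ p_{2n}(l)^2 X^(4n) / (4n)`. -/
noncomputable def psumSqSeries (l : List ℚ) : PowerSeries ℚ :=
  PowerSeries.mk fun m => if 4 ∣ m ∧ m ≠ 0 then psum (m / 2) l ^ 2 / (m : ℚ) else 0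

/-- The values at `l` of the series under consideration, graded by degree. -/
noncomputable def reducedLog (l : List ℚ) : PowerSeries ℚ :=
  PowerSeries.logOf (blockSeries l) - psumSqSeries l

theorem schurEval_bot (l : List ℚ) : schurEval l ⊥ = 1 := by
  induction l with
  | nil => simp [schurEval]
  | cons x l ih =>
    have : below ⊥ = {⊥} := by
      ext κ
      simp [hStrip_bot_right]
    rw [schurEval, this, Finset.sum_singleton, ih]
    simp

theorem card_eq_zero_iff {μ : YoungDiagram} : μ.card = 0 ↔ μ = ⊥ := by
  refine ⟨fun h => YoungDiagram.ext (Finset.card_eq_zero.mp h), ?_⟩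
  rintro rfl
  rfl

theorem isBlock_bot : IsBlock ⊥ := by
  intro k
  simp [rowLen_eq_zero (μ := ⊥) (Nat.zero_le _)]

theorem constantCoeff_blockSeries (l : List ℚ) :
    PowerSeries.constantCoeff (blockSeries l) = 1 := by
  classical
  rw [← PowerSeries.coeff_zero_eq_constantCoeff_apply, blockSeries, PowerSeries.coeff_mk]
  have : ({ρ ∈ upTo 0 | IsBlock ρ ∧ ρ.card = 0} : Finset _) = {⊥} := by
    ext ρ
    simp only [Finset.mem_filter, mem_upTo, Finset.mem_singleton, ← card_eq_zero_iff]
    refine ⟨fun h => h.2.2, fun h => ⟨h.le, ?_, h⟩⟩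
    rw [card_eq_zero_iff.mp h]
    exact isBlock_bot
  rw [this, Finset.sum_singleton, schurEval_bot]

/-- With m = 4n, the difference of squares is (2t^{2n} + p_{2n})² - p_{2n}² = 4t^{4n} +
4t^{2n}p_{2n}. Divided by 4n, the two terms are the coefficients of -log(1 - t⁴X⁴) and of -∑ log(1 -
t²x²X⁴). -/
theorem reducedLog_cons_cons_neg (t : ℚ) (l : List ℚ) :
    reducedLog (t :: -t :: l) = reducedLog l := by
  have hL : ∀ f ∈ (l.map fun x => 1 - PowerSeries.C (t ^ 2 * x ^ 2) * PowerSeries.X ^ 4),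
      PowerSeries.constantCoeff f = 1 := by
    intro f hf
    obtain ⟨x, _, rfl⟩ := List.mem_map.mp hf
    exact constantCoeff_one_sub _
  have key := congrArg PowerSeries.logOf (blockSeries_cons_cons_neg t l)
  rw [logOf_mul (constantCoeff_blockSeries _) (by
      rw [map_mul, constantCoeff_one_sub, constantCoeff_list_prod hL, one_mul]),
    logOf_mul (constantCoeff_one_sub _) (constantCoeff_list_prod hL), logOf_list_prod hL,
    List.map_map] at key
  rw [reducedLog, reducedLog, ← key]
  ext m
  have hsum : ∀ l : List ℚ, PowerSeries.coeff m (l.map (PowerSeries.logOf ∘ fun x =>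
      1 - PowerSeries.C (t ^ 2 * x ^ 2) * PowerSeries.X ^ 4)).sum
      = if 4 ∣ m ∧ m ≠ 0 then -(4 * t ^ (m / 2) * psum (m / 2) l / m) else 0 := by
    intro l
    induction l with
    | nil => simp [psum_nil]
    | cons x l ih =>
      rw [List.map_cons, List.sum_cons, map_add, ih, Function.comp_apply, logOf_one_sub, map_neg,
        PowerSeries.coeff_mk]
      split_ifs with h
      · rw [psum_cons, mul_pow, ← pow_mul, ← pow_mul, show 2 * (m / 4) = m / 2 by omega]
        ring
      · simp
  simp only [map_sub, map_add, hsum, logOf_one_sub, map_neg, psumSqSeries, PowerSeries.coeff_mk]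
  split_ifs with h
  · have h1 : Even (m / 2) := by rw [Nat.even_iff]; omega
    rw [psum_cons, psum_cons, h1.neg_pow, ← pow_mul, show 4 * (m / 4) = m / 2 + m / 2 by omega,
      pow_add]
    ring
  · simp

/-! ### Polynomials in the power sums -/

/-- The function `φ` of a list of numbers is a polynomial in the power sums. -/
def IsPSumPoly (φ : List ℚ → ℚ) : Prop :=
  ∃ G : MvPolynomial ℕ ℚ, ∀ l, φ l = MvPolynomial.eval (fun k => psum k l) G

namespace IsPSumPoly

theorem const (c : ℚ) : IsPSumPoly fun _ => c :=
  ⟨MvPolynomial.C c, fun _ => by simp⟩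

theorem psum (k : ℕ) : IsPSumPoly (psum k) :=
  ⟨MvPolynomial.X k, fun _ => by simp⟩

theorem add {φ ψ : List ℚ → ℚ} (hφ : IsPSumPoly φ) (hψ : IsPSumPoly ψ) :
    IsPSumPoly fun l => φ l + ψ l := by
  obtain ⟨G, hG⟩ := hφ
  obtain ⟨H, hH⟩ := hψ
  exact ⟨G + H, fun l => by beta_reduce; rw [map_add, hG, hH]⟩

theorem mul {φ ψ : List ℚ → ℚ} (hφ : IsPSumPoly φ) (hψ : IsPSumPoly ψ) :
    IsPSumPoly fun l => φ l * ψ l := by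
  obtain ⟨G, hG⟩ := hφ
  obtain ⟨H, hH⟩ := hψ
  exact ⟨G * H, fun l => by beta_reduce; rw [map_mul, hG, hH]⟩

theorem sub {φ ψ : List ℚ → ℚ} (hφ : IsPSumPoly φ) (hψ : IsPSumPoly ψ) :
    IsPSumPoly fun l => φ l - ψ l := by
  obtain ⟨G, hG⟩ := hφ
  obtain ⟨H, hH⟩ := hψ
  exact ⟨G - H, fun l => by beta_reduce; rw [map_sub, hG, hH]⟩

theorem sum {ι : Type*} {s : Finset ι} {φ : ι → List ℚ → ℚ} (h : ∀ i ∈ s, IsPSumPoly (φ i)) :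
    IsPSumPoly fun l => ∑ i ∈ s, φ i l := by
  classical
  induction s using Finset.induction_on with
  | empty => simpa using const 0
  | insert i s hi ih =>
    simp only [Finset.sum_insert hi]
    exact (h i (by simp)).add (ih fun j hj => h j (by simp [hj]))

end IsPSumPoly

/-- Newton's identities for the complete homogeneous symmetric functions. -/
theorem natCast_mul_hEval (l : List ℚ) (n : ℕ) :
    ((n + 1 : ℕ) : ℚ) * hEval l (n + 1)
      = ∑ k ∈ Finset.range (n + 1), psum (k + 1) l * hEval l (n - k) := by
  let H : List ℚ → PowerSeries ℚ := fun l => PowerSeries.mk (hEval l)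
  let P : List ℚ → PowerSeries ℚ := fun l => PowerSeries.mk fun k => psum (k + 1) l
  have hH : ∀ x l, H (x :: l) * (1 - PowerSeries.C x * PowerSeries.X ^ 1) = H l := by
    intro x l
    ext m
    rw [coeff_mul_one_sub]
    simp only [H, PowerSeries.coeff_mk]
    rcases m with _ | m
    · simp [hEval_zero]
    · rw [if_pos (by omega), hEval_cons_succ, Nat.add_sub_cancel]
      ring
  -- The differential equation H' = PH, by induction on the list: H acquires the factor 1/(1 - xX)
  -- and P the summand x/(1 - xX).
  have key : ∀ l, PowerSeries.derivative ℚ (H l) = P l * H l := by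
    intro l
    induction l with
    | nil =>
      have h1 : H [] = 1 := by
        ext m
        simp [H, hEval, PowerSeries.coeff_one]
      have h2 : P [] = 0 := by
        ext m
        simp [P, psum_nil]
      rw [h1, h2]
      simp
    | cons x l ih =>
      have hG : (PowerSeries.mk fun k => x ^ (k + 1))
          * (1 - PowerSeries.C x * PowerSeries.X ^ 1) = PowerSeries.C x := by
        ext m
        rw [coeff_mul_one_sub, PowerSeries.coeff_mk]
        rcases m with _ | m
        · simp
        · rw [if_pos (by omega), PowerSeries.coeff_mk, PowerSeries.coeff_C,
            if_neg (Nat.succ_ne_zero m), Nat.add_sub_cancel]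
          ring
      have hP : P (x :: l) = (PowerSeries.mk fun k => x ^ (k + 1)) + P l := by
        ext m
        simp [P, psum_cons]
      have h0 : (1 - PowerSeries.C x * PowerSeries.X ^ 1 : PowerSeries ℚ) ≠ 0 := by
        intro h
        have := congrArg PowerSeries.constantCoeff h
        simp at this
      refine mul_right_cancel₀ h0 ?_
      have hD := congrArg (PowerSeries.derivative ℚ) (hH x l)
      rw [ih, Derivation.leibniz, map_sub, Derivation.leibniz, pow_one, PowerSeries.derivative_X,
        PowerSeries.derivative_C, ← hH x l] at hD
      simp only [smul_eq_mul, mul_zero, add_zero, mul_one, Derivation.map_one_eq_zero] at hD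
      rw [pow_one] at *
      rw [hP]
      linear_combination hD - H (x :: l) * hG
  have := congrArg (PowerSeries.coeff n) (key l)
  rw [PowerSeries.coeff_derivative, PowerSeries.coeff_mul,
    Finset.Nat.sum_antidiagonal_eq_sum_range_succ_mk] at this
  simp only [H, P, PowerSeries.coeff_mk] at this
  rw [← this]
  push_cast
  ring

theorem isPSumPoly_hEval (n : ℕ) : IsPSumPoly fun l => hEval l n := by
  induction n using Nat.strong_induction_on with
  | _ n ih =>
    rcases n with _ | n
    · simpa only [hEval_zero] using IsPSumPoly.const 1
    · have h : (fun l => hEval l (n + 1)) = fun l => ((n + 1 : ℕ) : ℚ)⁻¹ *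
          ∑ k ∈ Finset.range (n + 1), psum (k + 1) l * hEval l (n - k) := by
        funext l
        rw [← natCast_mul_hEval, inv_mul_cancel_left₀ (by positivity)]
      rw [h]
      exact (IsPSumPoly.const _).mul (IsPSumPoly.sum fun k _ =>
        (IsPSumPoly.psum _).mul (ih _ (by omega)))

/-- Induction on the number of rows and then on the length `j` of the last row. Remove the last row
and multiply by `h_j`: in the Pieri expansion, `μ` is the term with the longest possible last row,
and all others come earlier in the induction. -/
theorem isPSumPoly_schurEval (μ : YoungDiagram) : IsPSumPoly fun l => schurEval l μ := by
  classical
  suffices h : ∀ r, ∀ μ : YoungDiagram, μ.rowLen r = 0 → IsPSumPoly fun l => schurEval l μ from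
    h μ.card μ (rowLen_eq_zero le_rfl)
  intro r
  induction r with
  | zero =>
    intro μ hμ
    have : μ = ⊥ := card_eq_zero_iff.mp (by rw [card_eq_sum_rowLen hμ]; simp)
    subst this
    simpa only [schurEval_bot] using IsPSumPoly.const 1
  | succ r ihr =>
    suffices h : ∀ j, ∀ μ : YoungDiagram, μ.rowLen (r + 1) = 0 → μ.rowLen r = j →
        IsPSumPoly fun l => schurEval l μ from fun μ hμ => h _ μ hμ rfl
    intro j
    induction j using Nat.strong_induction_on with
    | _ j ihj =>
      intro μ hμ hj
      let f : ℕ → ℕ := fun i => if i < r then μ.rowLen i else 0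
      have hlam : ∀ i, (diagram f).rowLen i = f i := by
        refine rowLen_diagram (K := r) (fun i => ?_) (by simp [f])
        have := rowLen_antitone μ i.le_succ
        simp only [f]
        split_ifs <;> omega
      set lam := diagram f
      have h0 : lam.rowLen r = 0 := by rw [hlam]; simp [f]
      have hc : lam.card + j = μ.card := by
        rw [card_eq_sum_rowLen h0, card_eq_sum_rowLen hμ, Finset.sum_range_succ, hj]
        congr 1
        refine Finset.sum_congr rfl fun i hi => ?_
        rw [hlam]
        exact if_pos (Finset.mem_range.mp hi)
      have hmem : μ ∈ above lam (lam.card + j) := by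
        rw [mem_above]
        refine ⟨fun i => ?_, hc.symm⟩
        rw [hlam]
        simp only [f]
        split_ifs with hi
        · exact ⟨rowLen_antitone μ i.le_succ, le_rfl⟩
        · have := rowLen_antitone μ (show r + 1 ≤ i + 1 by omega)
          omega
      have hrest : ∀ ν ∈ (above lam (lam.card + j)).erase μ,
          IsPSumPoly fun l => schurEval l ν := by
        intro ν hν
        obtain ⟨hne, hν⟩ := Finset.mem_erase.mp hν
        obtain ⟨hs, hνc⟩ := mem_above.mp hν
        have h1 : ν.rowLen (r + 1) = 0 := by have := hs r; omega
        refine ihj _ ?_ ν h1 rfl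
        have h2 := card_eq_sum_rowLen h1
        rw [Finset.sum_range_succ] at h2
        have h3 := card_eq_sum_rowLen h0
        have h4 : ∀ i ∈ Finset.range r, lam.rowLen i ≤ ν.rowLen i := fun i _ => (hs i).2
        -- If row `r` of `ν` had length at least `j`, the whole strip of size `j` would lie in that
        -- row, and `ν` would be `μ`.
        by_contra hlt
        have h5 := Finset.sum_le_sum h4
        have h6 := (Finset.sum_eq_sum_iff_of_le h4).mp (by omega)
        refine hne (rowLen_ext fun i => ?_)
        rcases lt_trichotomy i r with hi | rfl | hi
        · rw [← h6 i (Finset.mem_range.mpr hi), hlam]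
          simp [f, hi]
        · omega
        · have := rowLen_antitone ν (show r + 1 ≤ i by omega)
          have := rowLen_antitone μ (show r + 1 ≤ i by omega)
          omega
      have hsum : (fun l => schurEval l μ) = fun l => hEval l j * schurEval l lam
          - ∑ ν ∈ (above lam (lam.card + j)).erase μ, schurEval l ν := by
        funext l
        rw [← sum_above_schurEval, ← Finset.sum_erase_add _ _ hmem]
        ring
      rw [hsum]
      exact ((isPSumPoly_hEval j).mul (ihr lam h0)).sub (IsPSumPoly.sum hrest)

theorem isPSumPoly_coeff_blockSeries (n : ℕ) :
    IsPSumPoly fun l => PowerSeries.coeff n (blockSeries l) := by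
  simp only [blockSeries, PowerSeries.coeff_mk]
  exact IsPSumPoly.sum fun μ _ => isPSumPoly_schurEval μ

/-- The equation (log B)' B = B', with constant term 1, expresses each coefficient of log B through
earlier ones and coefficients of B. -/
theorem isPSumPoly_coeff_logOf (n : ℕ) :
    IsPSumPoly fun l => PowerSeries.coeff n (PowerSeries.logOf (blockSeries l)) := by
  induction n using Nat.strong_induction_on with
  | _ n ih =>
    rcases n with _ | n
    · simp only [PowerSeries.coeff_zero_eq_constantCoeff_apply,
        PowerSeries.constantCoeff_logOf (constantCoeff_blockSeries _)]
      exact IsPSumPoly.const 0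
    · have h : (fun l => PowerSeries.coeff (n + 1) (PowerSeries.logOf (blockSeries l)))
          = fun l => ((n : ℚ) + 1)⁻¹ * (PowerSeries.coeff (n + 1) (blockSeries l) * ((n : ℚ) + 1)
            - ∑ i ∈ Finset.range n, PowerSeries.coeff (i + 1) (PowerSeries.logOf (blockSeries l))
                * ((i : ℚ) + 1) * PowerSeries.coeff (n - i) (blockSeries l)) := by
        funext l
        have h1 := congrArg (PowerSeries.coeff n)
          (derivative_logOf_mul (constantCoeff_blockSeries l))
        rw [PowerSeries.coeff_derivative, PowerSeries.coeff_mul,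
          Finset.Nat.sum_antidiagonal_eq_sum_range_succ_mk, Finset.sum_range_succ, Nat.sub_self,
          PowerSeries.coeff_zero_eq_constantCoeff_apply, constantCoeff_blockSeries,
          mul_one] at h1
        simp only [PowerSeries.coeff_derivative] at h1
        rw [← h1, add_sub_cancel_left]
        field_simp
      rw [h]
      exact (IsPSumPoly.const _).mul (((isPSumPoly_coeff_blockSeries _).mul (.const _)).sub
        (IsPSumPoly.sum fun i hi => ((ih _ (by simp at hi; omega)).mul (.const _)).mul
          (isPSumPoly_coeff_blockSeries _)))

theorem isPSumPoly_coeff_reducedLog (n : ℕ) :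
    IsPSumPoly fun l => PowerSeries.coeff n (reducedLog l) := by
  simp only [reducedLog, map_sub, psumSqSeries, PowerSeries.coeff_mk]
  refine (isPSumPoly_coeff_logOf n).sub ?_
  split_ifs
  · simp only [pow_two, div_eq_mul_inv]
    exact ((IsPSumPoly.psum _).mul (.psum _)).mul (.const _)
  · exact IsPSumPoly.const 0

/-! ### Eliminating the even power sums -/

/-- The list `l` with the numbers `t, -t` adjoined for all entries `t` of `l'`. -/
def adjoinPairs : List ℚ → List ℚ → List ℚ
  | [], l => l
  | t :: l', l => t :: -t :: adjoinPairs l' l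

theorem reducedLog_adjoinPairs (l' l : List ℚ) :
    reducedLog (adjoinPairs l' l) = reducedLog l := by
  induction l' with
  | nil => rfl
  | cons t l' ih => rw [adjoinPairs, reducedLog_cons_cons_neg, ih]

theorem psum_adjoinPairs (k : ℕ) (l' l : List ℚ) :
    psum k (adjoinPairs l' l) = (if Even k then 2 * psum k l' else 0) + psum k l := by
  induction l' with
  | nil => simp [adjoinPairs, psum_nil]
  | cons t l' ih =>
    rw [adjoinPairs, psum_cons, psum_cons, psum_cons, ih]
    split_ifs with h
    · rw [h.neg_pow]; ring
    · rw [(Nat.not_even_iff_odd.mp h).neg_pow]; ring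

theorem exists_psum_eq (l : List ℚ) (m : ℕ) : ∃ l', reducedLog l' = reducedLog l ∧
    ∀ k, psum k l' = (if Even k then 1 + 2 * (m : ℚ) else 1) * psum k l := by
  induction m with
  | zero => exact ⟨l, rfl, fun k => by simp⟩
  | succ m ih =>
    obtain ⟨l', h1, h2⟩ := ih
    -- The pairs are always taken from the original `l`, not from `l'`, so the even factor grows
    -- linearly in `m`.
    refine ⟨adjoinPairs l l', by rw [reducedLog_adjoinPairs, h1], fun k => ?_⟩
    rw [psum_adjoinPairs, h2]
    push_cast
    split_ifs <;> ring

/-- The coefficients of `reducedLog` are polynomials in the odd power sums: a polynomial in `m`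
which is constant at all natural numbers is also constant at `-1/2`, where the even power sums
are scaled by `0`. -/
theorem exists_coeff_reducedLog_eq (n : ℕ) : ∃ G : MvPolynomial ℕ ℚ, ∀ l,
    PowerSeries.coeff n (reducedLog l)
      = MvPolynomial.eval (fun k => psum (2 * k + 1) l) G := by
  obtain ⟨G, hG⟩ := isPSumPoly_coeff_reducedLog n
  beta_reduce at hG
  refine ⟨MvPolynomial.bind₁ (fun k => if Even k then 0 else MvPolynomial.X (k / 2)) G,
    fun l => ?_⟩
  let g : Polynomial ℚ := MvPolynomial.eval₂ Polynomial.C (fun k =>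
    (if Even k then 1 + 2 * Polynomial.X else 1) * Polynomial.C (psum k l)) G
  have hg : ∀ c : ℚ, Polynomial.eval c g = MvPolynomial.eval
      (fun k => (if Even k then 1 + 2 * c else 1) * psum k l) G := by
    intro c
    rw [MvPolynomial.polynomial_eval_eval₂, MvPolynomial.eval, MvPolynomial.coe_eval₂Hom]
    congr 1
    · ext; simp
    · funext k
      split_ifs <;> simp
  -- At `c = m` the value of `g` is the coefficient for a list with the same reduced logarithm as
  -- `l`; hence `g` is constant on ℕ.
  have hconst : g = Polynomial.C (PowerSeries.coeff n (reducedLog l)) := by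
    refine Polynomial.eq_of_infinite_eval_eq _ _
      ((Set.infinite_range_of_injective (Nat.cast_injective (R := ℚ))).mono ?_)
    rintro _ ⟨m, rfl⟩
    obtain ⟨l', h1, h2⟩ := exists_psum_eq l m
    rw [Set.mem_ofPred_eq, hg, Polynomial.eval_C, ← h1, hG]
    simp only [h2]
  have h := hg (-1 / 2)
  rw [hconst, Polynomial.eval_C] at h
  rw [h]
  simp only [MvPolynomial.eval, MvPolynomial.eval₂Hom_bind₁]
  congr 2
  funext k
  split_ifs with hk
  · norm_num
  · have : 2 * (k / 2) + 1 = k := by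
      rw [Nat.not_even_iff] at hk
      omega
    simp [this]

/-! ### The branching rule for semistandard tableaux -/

theorem mem_support_weight {μ : YoungDiagram} {T : SemistandardYoungTableau μ} {k : ℕ} :
    k ∈ (weight T).support ↔ ∃ c ∈ μ.cells, T c.1 c.2 = k := by
  rw [Finsupp.mem_support_iff, weight, Finsupp.finsetSum_apply, ne_eq, Finset.sum_eq_zero_iff]
  simp only [Finsupp.single_apply, ite_eq_right_iff, one_ne_zero, imp_false, not_forall,
    not_not, exists_prop]

theorem weight_mem_finsuppAntidiag {μ : YoungDiagram} {T : SemistandardYoungTableau μ} {N : ℕ} :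
    weight T ∈ Finset.finsuppAntidiag (Finset.range N) μ.card
      ↔ ∀ c ∈ μ.cells, T c.1 c.2 < N := by
  have h : (weight T).sum (fun _ x => x) = μ.card := degree_weight T
  rw [Finset.mem_finsuppAntidiag', and_iff_right h]
  constructor
  · intro hs c hc
    exact Finset.mem_range.mp (hs (mem_support_weight.mpr ⟨c, hc, rfl⟩))
  · intro hT k hk
    obtain ⟨c, hc, rfl⟩ := mem_support_weight.mp hk
    exact Finset.mem_range.mpr (hT c hc)

theorem finite_tableaux (μ : YoungDiagram) (N : ℕ) :
    {T : SemistandardYoungTableau μ | ∀ c ∈ μ.cells, T c.1 c.2 < N}.Finite := by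
  refine Set.Finite.subset ((Finset.finite_toSet
    (Finset.finsuppAntidiag (Finset.range N) μ.card)).biUnion fun e _ => finite_weight_eq μ e) ?_
  intro T hT
  simp only [Set.mem_iUnion]
  exact ⟨weight T, weight_mem_finsuppAntidiag.mpr hT, rfl⟩

/-- The semistandard tableaux of shape `μ` with entries less than `N`. -/
noncomputable def tableaux (μ : YoungDiagram) (N : ℕ) : Finset (SemistandardYoungTableau μ) :=
  (finite_tableaux μ N).toFinset

theorem mem_tableaux {μ : YoungDiagram} {N : ℕ} {T : SemistandardYoungTableau μ} :
    T ∈ tableaux μ N ↔ ∀ c ∈ μ.cells, T c.1 c.2 < N := by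
  simp [tableaux]

/-- The shape formed by the entries less than `N`. -/
def subShape {μ : YoungDiagram} (T : SemistandardYoungTableau μ) (N : ℕ) : YoungDiagram where
  cells := {c ∈ μ.cells | T c.1 c.2 < N}
  isLowerSet := by
    rintro ⟨a, b⟩ ⟨c, d⟩ ⟨h1, h2⟩ h
    simp only [Finset.coe_filter, Set.mem_ofPred_eq, YoungDiagram.mem_cells] at h ⊢
    have hcb := μ.up_left_mem (i1 := a) (j1 := d) le_rfl h2 h.1
    exact ⟨μ.up_left_mem h1 h2 h.1,
      ((T.col_weak h1 hcb).trans (T.row_weak_of_le h2 h.1)).trans_lt h.2⟩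

theorem mem_subShape {μ : YoungDiagram} {T : SemistandardYoungTableau μ} {N : ℕ} {c : ℕ × ℕ} :
    c ∈ subShape T N ↔ c ∈ μ ∧ T c.1 c.2 < N := by
  rw [← YoungDiagram.mem_cells, subShape, Finset.mem_filter, YoungDiagram.mem_cells]

/-- The interlacing condition in terms of cells: no column contains two removed cells. This is the
form in which strictness along columns gives and uses strips. -/
theorem hStrip_iff {κ μ : YoungDiagram} :
    HStrip κ μ ↔ κ ≤ μ ∧ ∀ i j, (i + 1, j) ∈ μ → (i, j) ∈ κ := by
  constructor
  · refine fun h => ⟨h.le, fun i j hij => ?_⟩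
    rw [YoungDiagram.mem_iff_lt_rowLen] at *
    exact hij.trans_le (h i).1
  · rintro ⟨h1, h2⟩ i
    refine ⟨le_of_forall_lt fun j hj => ?_, le_of_forall_lt fun j hj => ?_⟩
    · exact YoungDiagram.mem_iff_lt_rowLen.mp (h2 i j (YoungDiagram.mem_iff_lt_rowLen.mpr hj))
    · exact YoungDiagram.mem_iff_lt_rowLen.mp (h1 (YoungDiagram.mem_iff_lt_rowLen.mpr hj))

theorem hStrip_subShape {μ : YoungDiagram} {T : SemistandardYoungTableau μ} {N : ℕ}
    (hT : T ∈ tableaux μ (N + 1)) : HStrip (subShape T N) μ := by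
  refine hStrip_iff.mpr ⟨fun c hc => (mem_subShape.mp hc).1, fun i j hij => ?_⟩
  have h1 : T (i + 1) j < N + 1 := mem_tableaux.mp hT (i + 1, j) hij
  have h2 : T i j < T (i + 1) j := T.col_strict (Nat.lt_succ_self i) hij
  exact mem_subShape.mpr ⟨μ.up_left_mem (Nat.le_succ i) le_rfl hij, by simp only at *; omega⟩

open Classical in
/-- The restriction of a tableau to a smaller shape. -/
noncomputable def restrictTableau {κ μ : YoungDiagram} (h : κ ≤ μ) (T : SemistandardYoungTableau μ) :
    SemistandardYoungTableau κ where
  entry i j := if (i, j) ∈ κ then T i j else 0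
  row_weak' := by
    intro i j1 j2 hj hc
    rw [if_pos hc, if_pos (κ.up_left_mem le_rfl hj.le hc)]
    exact T.row_weak hj (h hc)
  col_strict' := by
    intro i1 i2 j hi hc
    rw [if_pos hc, if_pos (κ.up_left_mem hi.le le_rfl hc)]
    exact T.col_strict hi (h hc)
  zeros' := fun hc => if_neg hc

open Classical in
/-- The extension of a tableau with entries less than `N` by entries `N` in a horizontal strip. -/
noncomputable def extendTableau {κ μ : YoungDiagram} (h : HStrip κ μ) {N : ℕ}
    (T : SemistandardYoungTableau κ) (hT : T ∈ tableaux κ N) : SemistandardYoungTableau μ where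
  entry i j := if (i, j) ∈ κ then T i j else if (i, j) ∈ μ then N else 0
  row_weak' := by
    intro i j1 j2 hj hc
    have hc1 := μ.up_left_mem le_rfl hj.le hc
    rw [if_pos hc, if_pos hc1]
    by_cases h2 : (i, j2) ∈ κ
    · rw [if_pos h2, if_pos (κ.up_left_mem le_rfl hj.le h2)]
      exact T.row_weak hj h2
    · rw [if_neg h2]
      split_ifs with h1
      · exact (mem_tableaux.mp hT (i, j1) h1).le
      · exact le_rfl
  col_strict' := by
    intro i1 i2 j hi hc
    have h1 : (i1, j) ∈ κ := (hStrip_iff.mp h).2 i1 j (μ.up_left_mem hi le_rfl hc)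
    rw [if_pos h1, if_pos hc]
    split_ifs with h2
    · exact T.col_strict hi h2
    · exact mem_tableaux.mp hT (i1, j) h1
  zeros' := fun hc => by
    rw [if_neg fun h' => hc (h.le h'), if_neg hc]

theorem restrictTableau_apply {κ μ : YoungDiagram} (h : κ ≤ μ) (T : SemistandardYoungTableau μ)
    {i j : ℕ} (hc : (i, j) ∈ κ) : restrictTableau h T i j = T i j :=
  if_pos hc

theorem extendTableau_apply {κ μ : YoungDiagram} (h : HStrip κ μ) {N : ℕ}
    (T : SemistandardYoungTableau κ) (hT : T ∈ tableaux κ N) {i j : ℕ} (hc : (i, j) ∈ κ) :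
    extendTableau h T hT i j = T i j :=
  if_pos hc

theorem extendTableau_apply_of_notMem {κ μ : YoungDiagram} (h : HStrip κ μ) {N : ℕ}
    (T : SemistandardYoungTableau κ) (hT : T ∈ tableaux κ N) {i j : ℕ} (hc : (i, j) ∉ κ)
    (hc' : (i, j) ∈ μ) : extendTableau h T hT i j = N :=
  (if_neg hc).trans (if_pos hc')

/-- The cells with the largest entry `N` form a horizontal strip, and conversely any horizontal
strip can be filled with `N`; fibring over the shape of the smaller entries gives the branching
rule. -/
theorem sum_tableaux_succ (μ : YoungDiagram) (N : ℕ) (a : ℕ → ℚ) :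
    ∑ T ∈ tableaux μ (N + 1), ∏ c ∈ μ.cells, a (T c.1 c.2)
      = ∑ κ ∈ below μ, a N ^ (μ.card - κ.card)
        * ∑ T ∈ tableaux κ N, ∏ c ∈ κ.cells, a (T c.1 c.2) := by
  classical
  rw [← Finset.sum_fiberwise_of_maps_to (t := below μ) (g := fun T => subShape T N)
    fun T hT => mem_below.mpr (hStrip_subShape hT)]
  refine Finset.sum_congr rfl fun κ hκ => ?_
  have hs := mem_below.mp hκ
  rw [Finset.mul_sum]
  have hmem : ∀ T ∈ {T ∈ tableaux μ (N + 1) | subShape T N = κ}, ∀ c,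
      c ∈ κ ↔ c ∈ μ ∧ T c.1 c.2 < N := by
    intro T hT c
    rw [← (Finset.mem_filter.mp hT).2, mem_subShape]
  have hN : ∀ T ∈ {T ∈ tableaux μ (N + 1) | subShape T N = κ}, ∀ c ∈ μ, c ∉ κ →
      T c.1 c.2 = N := by
    intro T hT c hc hcκ
    have h1 := mem_tableaux.mp (Finset.mem_filter.mp hT).1 c hc
    have h2 : ¬ T c.1 c.2 < N := fun h => hcκ ((hmem T hT c).mpr ⟨hc, h⟩)
    omega
  refine Finset.sum_bij (fun T _ => restrictTableau hs.le T) ?_ ?_ ?_ ?_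
  · intro T hT
    refine mem_tableaux.mpr fun c hc => ?_
    rw [restrictTableau_apply hs.le T hc]
    exact ((hmem T hT c).mp hc).2
  · intro T hT T' hT' heq
    ext i j
    by_cases hκ : (i, j) ∈ κ
    · rw [← restrictTableau_apply hs.le T hκ, heq, restrictTableau_apply hs.le T' hκ]
    · by_cases hμ : (i, j) ∈ μ
      · rw [hN T hT (i, j) hμ hκ, hN T' hT' (i, j) hμ hκ]
      · rw [T.zeros hμ, T'.zeros hμ]
  · intro T hT
    have hlt : ∀ c ∈ κ, T c.1 c.2 < N := mem_tableaux.mp hT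
    refine ⟨extendTableau hs T hT, Finset.mem_filter.mpr ⟨mem_tableaux.mpr fun c hc => ?_, ?_⟩, ?_⟩
    · by_cases hκ : c ∈ κ
      · rw [extendTableau_apply hs T hT hκ]
        exact (hlt c hκ).trans (Nat.lt_succ_self N)
      · rw [extendTableau_apply_of_notMem hs T hT hκ hc]
        exact Nat.lt_succ_self N
    · ext c
      rw [YoungDiagram.mem_cells, YoungDiagram.mem_cells, mem_subShape]
      constructor
      · rintro ⟨h1, h2⟩
        by_contra hκ
        rw [extendTableau_apply_of_notMem hs T hT hκ h1] at h2
        exact lt_irrefl _ h2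
      · intro hκ
        rw [extendTableau_apply hs T hT hκ]
        exact ⟨hs.le hκ, hlt c hκ⟩
    · ext i j
      by_cases hκ : (i, j) ∈ κ
      · rw [restrictTableau_apply hs.le _ hκ, extendTableau_apply hs T hT hκ]
      · rw [T.zeros hκ, (restrictTableau hs.le _).zeros hκ]
  · intro T hT
    have hsub : κ.cells ⊆ μ.cells := hs.le
    rw [← Finset.prod_sdiff hsub]
    congr 1
    · rw [YoungDiagram.card, YoungDiagram.card, ← Finset.card_sdiff_of_subset hsub,
        ← Finset.prod_const]
      refine Finset.prod_congr rfl fun c hc => ?_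
      obtain ⟨h1, h2⟩ := Finset.mem_sdiff.mp hc
      rw [hN T hT c h1 h2]
    · exact Finset.prod_congr rfl fun c hc => by rw [restrictTableau_apply hs.le T hc]

/-- The list is reversed because `schurEval` peels off its head, which must belong to the largest
entry. -/
theorem sum_tableaux (μ : YoungDiagram) (N : ℕ) (a : ℕ → ℚ) :
    ∑ T ∈ tableaux μ N, ∏ c ∈ μ.cells, a (T c.1 c.2)
      = schurEval ((List.range N).reverse.map a) μ := by
  induction N generalizing μ with
  | zero =>
    rw [List.range_zero, List.reverse_nil, List.map_nil, schurEval]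
    split_ifs with h
    · subst h
      have : tableaux ⊥ 0 = {SemistandardYoungTableau.highestWeight ⊥} := by
        ext T
        rw [mem_tableaux, Finset.mem_singleton]
        refine ⟨fun _ => ?_, fun _ => by simp⟩
        ext i j
        rw [T.zeros (YoungDiagram.notMem_bot _),
          (SemistandardYoungTableau.highestWeight ⊥).zeros (YoungDiagram.notMem_bot _)]
      simp [this]
    · refine Finset.sum_eq_zero fun T hT => ?_
      have hμ : μ.cells.Nonempty :=
        Finset.nonempty_iff_ne_empty.mpr fun h' => h (YoungDiagram.ext h')
      obtain ⟨c, hc⟩ := hμ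
      exact absurd (mem_tableaux.mp hT c hc) (Nat.not_lt_zero _)
  | succ N ih =>
    rw [sum_tableaux_succ, List.range_succ, List.reverse_append, List.reverse_singleton,
      List.singleton_append, List.map_cons, schurEval]
    exact Finset.sum_congr rfl fun κ _ => by rw [ih]

/-- The Schur function defined by tableaux, evaluated at finitely many numbers. -/
theorem sum_coeff_schur (μ : YoungDiagram) (N : ℕ) (a : ℕ → ℚ) :
    ∑ e ∈ Finset.finsuppAntidiag (Finset.range N) μ.card,
        MvPowerSeries.coeff e (schur μ) * ∏ i ∈ Finset.range N, a i ^ e i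
      = schurEval ((List.range N).reverse.map a) μ := by
  classical
  rw [← sum_tableaux, ← Finset.sum_fiberwise_of_maps_to (g := weight)
    fun T hT => weight_mem_finsuppAntidiag.mpr (mem_tableaux.mp hT)]
  refine Finset.sum_congr rfl fun e he => ?_
  have h1 : {T : SemistandardYoungTableau μ | weight T = e}
      = (({T ∈ tableaux μ N | weight T = e} : Finset _) : Set _) := by
    ext T
    simp only [Set.mem_ofPred_eq, Finset.coe_filter, iff_and_self]
    rintro rfl
    exact mem_tableaux.mpr (weight_mem_finsuppAntidiag.mp he)
  rw [coeff_schur, h1, Set.ncard_coe_finset, ← nsmul_eq_mul, ← Finset.sum_const]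
  refine Finset.sum_congr rfl fun T hT => ?_
  obtain ⟨hT', rfl⟩ := Finset.mem_filter.mp hT
  simp only [weight, Finsupp.finsetSum_apply, ← Finset.prod_pow_eq_pow_sum]
  rw [Finset.prod_comm]
  refine Finset.prod_congr rfl fun c hc => ?_
  simp only [Finsupp.single_apply, pow_ite, pow_one, pow_zero]
  rw [Finset.prod_ite_eq, if_pos (Finset.mem_range.mpr (mem_tableaux.mp hT' c hc))]

/-! ### Graded evaluation of symmetric series at finitely many numbers -/

/-- The values substituted for the variables: `a_i X` for `i < N`, and `0` for the others. -/
noncomputable def evalVar (a : ℕ → ℚ) (N : ℕ) (i : ℕ) : PowerSeries ℚ :=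
  if i < N then PowerSeries.C (a i) * PowerSeries.X else 0

theorem hasSubst_evalVar (a : ℕ → ℚ) (N : ℕ) : MvPowerSeries.HasSubst (evalVar a N) where
  const_coeff i := by
    have : PowerSeries.constantCoeff (evalVar a N i) = 0 := by
      rw [evalVar]; split_ifs <;> simp
    exact (show MvPowerSeries.constantCoeff (evalVar a N i) = 0 from this) ▸ IsNilpotent.zero
  coeff_zero d := by
    refine (Finset.range N).finite_toSet.subset fun i hi => ?_
    by_contra h
    exact hi (by rw [evalVar, if_neg (by simpa using h), map_zero])

/-- Evaluation at `a_0, …, a_(N-1)`, graded by the degree. -/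
noncomputable def gradedEval (a : ℕ → ℚ) (N : ℕ) : MvPowerSeries ℕ ℚ →ₐ[ℚ] PowerSeries ℚ :=
  MvPowerSeries.substAlgHom (hasSubst_evalVar a N)

theorem gradedEval_eq_subst (a : ℕ → ℚ) (N : ℕ) (f : MvPowerSeries ℕ ℚ) :
    gradedEval a N f = MvPowerSeries.subst (evalVar a N) f :=
  congrFun (MvPowerSeries.coe_substAlgHom _) f

theorem prod_evalVar_of_subset (a : ℕ → ℚ) {N : ℕ} {e : ℕ →₀ ℕ} (h : e.support ⊆ Finset.range N) :
    (e.prod fun i k => evalVar a N i ^ k)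
      = PowerSeries.C (∏ i ∈ Finset.range N, a i ^ e i) * PowerSeries.X ^ e.degree := by
  have hd : e.degree = ∑ i ∈ Finset.range N, e i :=
    Finset.sum_subset h fun i _ hi => Finsupp.notMem_support_iff.mp hi
  rw [Finsupp.prod_of_support_subset e h _ fun _ _ => pow_zero _, map_prod, hd,
    ← Finset.prod_pow_eq_pow_sum, ← Finset.prod_mul_distrib]
  refine Finset.prod_congr rfl fun i hi => ?_
  rw [evalVar, if_pos (Finset.mem_range.mp hi), mul_pow, map_pow]

/-- Only monomials of degree `n` in the first `N` variables contribute. As these are finitely many,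
infinite sums and uniqueness can be handled coefficientwise. -/
theorem coeff_gradedEval (a : ℕ → ℚ) (N n : ℕ) (f : MvPowerSeries ℕ ℚ) :
    PowerSeries.coeff n (gradedEval a N f)
      = ∑ e ∈ Finset.finsuppAntidiag (Finset.range N) n,
          MvPowerSeries.coeff e f * ∏ i ∈ Finset.range N, a i ^ e i := by
  have key : ∀ e : ℕ →₀ ℕ, PowerSeries.coeff n (e.prod fun i k => evalVar a N i ^ k)
      = if e ∈ Finset.finsuppAntidiag (Finset.range N) n
        then ∏ i ∈ Finset.range N, a i ^ e i else 0 := by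
    intro e
    by_cases h : e.support ⊆ Finset.range N
    · rw [prod_evalVar_of_subset a h, PowerSeries.coeff_C_mul, PowerSeries.coeff_X_pow,
        mul_ite, mul_one, mul_zero]
      refine if_congr ?_ rfl rfl
      rw [Finset.mem_finsuppAntidiag', and_iff_left h]
      exact eq_comm
    · rw [if_neg fun h' => h (Finset.mem_finsuppAntidiag.mp h').2]
      obtain ⟨i, hi, hN⟩ := Finset.not_subset.mp h
      rw [Finsupp.prod, Finset.prod_eq_zero hi, map_zero]
      rw [evalVar, if_neg (by simpa using hN), zero_pow (Finsupp.mem_support_iff.mp hi)]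
  have h0 : PowerSeries.coeff n (gradedEval a N f)
      = finsum fun e : ℕ →₀ ℕ => MvPowerSeries.coeff e f •
          PowerSeries.coeff n (e.prod fun i k => evalVar a N i ^ k) := by
    rw [gradedEval_eq_subst]
    exact MvPowerSeries.coeff_subst (hasSubst_evalVar a N) f _
  rw [h0, finsum_eq_sum_of_support_subset (s := Finset.finsuppAntidiag (Finset.range N) n)]
  · exact Finset.sum_congr rfl fun e he => by rw [key, if_pos he, smul_eq_mul]
  · intro e he
    by_contra h
    rw [Finset.mem_coe] at h
    exact he (by simp only [key, if_neg h, smul_zero])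

theorem coeff_gradedEval_mul_left (c : ℚ) (a : ℕ → ℚ) (N n : ℕ) (f : MvPowerSeries ℕ ℚ) :
    PowerSeries.coeff n (gradedEval (fun i => c * a i) N f)
      = c ^ n * PowerSeries.coeff n (gradedEval a N f) := by
  rw [coeff_gradedEval, coeff_gradedEval, Finset.mul_sum]
  refine Finset.sum_congr rfl fun e he => ?_
  simp only [mul_pow, Finset.prod_mul_distrib, Finset.prod_pow_eq_pow_sum]
  rw [(Finset.mem_finsuppAntidiag.mp he).1]
  ring

/-- A series all of whose evaluations vanish is zero. -/
theorem eq_zero_of_gradedEval {f : MvPowerSeries ℕ ℚ} (h : ∀ a N, gradedEval a N f = 0) :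
    f = 0 := by
  ext d
  obtain ⟨N, hN⟩ := d.support.exists_nat_subset_range
  set n := d.degree with hn
  set S := Finset.finsuppAntidiag (Finset.range N) n with hS
  have hd : d ∈ S := Finset.mem_finsuppAntidiag'.mpr ⟨hn.symm, hN⟩
  -- The part of `f` of degree `n` in the first `N` variables is a polynomial vanishing at all
  -- rational points, hence zero.
  have hP : (∑ e ∈ S, MvPolynomial.monomial e (MvPowerSeries.coeff e f)) = 0 := by
    refine MvPolynomial.funext fun a => ?_
    rw [map_sum, map_zero, ← map_zero (PowerSeries.coeff n), ← h a N, coeff_gradedEval]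
    refine Finset.sum_congr rfl fun e he => ?_
    rw [MvPolynomial.eval_monomial, Finsupp.prod_of_support_subset e
      (Finset.mem_finsuppAntidiag.mp he).2 _ fun _ _ => pow_zero _]
  have h1 := congrArg (MvPolynomial.coeff d) hP
  rw [MvPolynomial.coeff_sum, Finset.sum_eq_single_of_mem d hd] at h1
  · simpa using h1
  · intro e _ he
    rw [MvPolynomial.coeff_monomial, if_neg he]

theorem coeff_gradedEval_of_hasSum {ι : Type*} {g : ι → MvPowerSeries ℕ ℚ} {f : MvPowerSeries ℕ ℚ}
    (hs : HasSum g f) (a : ℕ → ℚ) {N n : ℕ} {S : Finset ι}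
    (h : ∀ i ∉ S, ∀ e ∈ Finset.finsuppAntidiag (Finset.range N) n,
      MvPowerSeries.coeff e (g i) = 0) :
    PowerSeries.coeff n (gradedEval a N f)
      = ∑ i ∈ S, PowerSeries.coeff n (gradedEval a N (g i)) := by
  rw [MvPowerSeries.WithPiTopology.hasSum_iff_hasSum_coeff] at hs
  simp only [coeff_gradedEval]
  rw [Finset.sum_comm]
  refine Finset.sum_congr rfl fun e he => ?_
  rw [← Finset.sum_mul, (hs e).unique (hasSum_sum_of_ne_finset_zero fun i hi => h i hi e he)]

/-- The list of the numbers `a_(N-1), …, a_0`. -/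
def values (a : ℕ → ℚ) (N : ℕ) : List ℚ := (List.range N).reverse.map a

theorem psum_values (k : ℕ) (a : ℕ → ℚ) (N : ℕ) :
    psum k (values a N) = ∑ i ∈ Finset.range N, a i ^ k := by
  induction N with
  | zero => rfl
  | succ N ih =>
    rw [Finset.sum_range_succ, ← ih, values, List.range_succ, List.reverse_append,
      List.reverse_singleton, List.singleton_append, List.map_cons, psum_cons, add_comm]
    rfl

theorem gradedEval_X_pow (a : ℕ → ℚ) {N i : ℕ} (hi : i < N) (k : ℕ) :
    gradedEval a N (MvPowerSeries.X i ^ k) = PowerSeries.C (a i ^ k) * PowerSeries.X ^ k := by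
  have h : gradedEval a N (MvPowerSeries.X i) = evalVar a N i :=
    MvPowerSeries.substAlgHom_X _ i
  rw [map_pow, h, evalVar, if_pos hi, mul_pow, map_pow]

theorem gradedEval_powerSum (a : ℕ → ℚ) (N : ℕ) {k : ℕ} (hk : k ≠ 0) :
    gradedEval a N (powerSum k) = PowerSeries.C (psum k (values a N)) * PowerSeries.X ^ k := by
  ext n
  rw [powerSum, coeff_gradedEval_of_hasSum (summable_X_pow hk).hasSum a (S := Finset.range N), psum_values,
    map_sum, Finset.sum_mul, map_sum]
  · exact Finset.sum_congr rfl fun i hi => by rw [gradedEval_X_pow a (Finset.mem_range.mp hi)]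
  · intro i hi e he
    rw [MvPowerSeries.coeff_X_pow, if_neg]
    rintro rfl
    refine hi ((Finset.mem_finsuppAntidiag.mp he).2 ?_)
    rw [Finsupp.support_single _ hk]
    exact Finset.mem_singleton_self i

theorem coeff_gradedEval_schur (a : ℕ → ℚ) (N n : ℕ) (μ : YoungDiagram) :
    PowerSeries.coeff n (gradedEval a N (schur μ))
      = if μ.card = n then schurEval (values a N) μ else 0 := by
  rw [coeff_gradedEval]
  split_ifs with h
  · subst h
    exact sum_coeff_schur μ N a
  · refine Finset.sum_eq_zero fun e he => ?_
    rw [coeff_schur_eq_zero, zero_mul]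
    have : e.degree = n := (Finset.mem_finsuppAntidiag'.mp he).1
    omega

theorem gradedEval_evenSchurSum (a : ℕ → ℚ) (N : ℕ) :
    gradedEval a N evenSchurSum = blockSeries (values a N) := by
  classical
  ext n
  rw [evenSchurSum, coeff_gradedEval_of_hasSum summable_schur.hasSum a
    (S := (finite_card_eq n).preimage Subtype.val_injective.injOn |>.toFinset), blockSeries,
    PowerSeries.coeff_mk]
  · refine Finset.sum_bij (fun μ _ => μ.1) ?_ ?_ ?_ ?_
    · intro μ hμ
      have hμ' : μ.1.card = n := by simpa using hμ
      exact Finset.mem_filter.mpr ⟨mem_upTo.mpr hμ'.le, (isEven_and_transpose_iff _).mp μ.2, hμ'⟩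
    · exact fun μ _ ν _ h => Subtype.ext h
    · intro μ hμ
      obtain ⟨-, h1, h2⟩ := Finset.mem_filter.mp hμ
      exact ⟨⟨μ, (isEven_and_transpose_iff _).mpr h1⟩, by simpa using h2, rfl⟩
    · intro μ hμ
      rw [coeff_gradedEval_schur, if_pos (by simpa using hμ)]
  · intro μ hμ e he
    refine coeff_schur_eq_zero fun h => hμ ?_
    have : e.degree = n := (Finset.mem_finsuppAntidiag'.mp he).1
    simp only [Set.Finite.mem_toFinset, Set.mem_preimage, Set.mem_ofPred_eq]
    omega

theorem gradedEval_formalLog (a : ℕ → ℚ) (N : ℕ) :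
    gradedEval a N (formalLog evenSchurSum) = PowerSeries.logOf (blockSeries (values a N)) := by
  rw [← gradedEval_evenSchurSum, PowerSeries.logOf_eq, ← map_one (gradedEval a N), ← map_sub,
    gradedEval_eq_subst, gradedEval_eq_subst, formalLog]
  exact MvPowerSeries.subst_comp_subst_apply hasSubst_evenSchurSum.const (hasSubst_evalVar a N) _

theorem gradedEval_tsum_powerSum_sq (a : ℕ → ℚ) (N : ℕ) :
    gradedEval a N (∑' n : ℕ+, (1 / (4 * (n : ℚ))) • powerSum (2 * n) ^ 2)
      = psumSqSeries (values a N) := by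
  have hterm : ∀ n : ℕ+, gradedEval a N ((1 / (4 * (n : ℚ))) • powerSum (2 * n) ^ 2)
      = PowerSeries.C (psum (2 * n) (values a N) ^ 2 / (4 * (n : ℚ)))
        * PowerSeries.X ^ (4 * (n : ℕ)) := by
    intro n
    rw [map_smul, map_pow, gradedEval_powerSum a N (by positivity), PowerSeries.smul_eq_C_mul,
      mul_pow, ← pow_mul, ← map_pow, ← mul_assoc, ← map_mul]
    congr 2 <;> ring
  ext m
  rw [psumSqSeries, PowerSeries.coeff_mk]
  by_cases hm : 4 ∣ m ∧ m ≠ 0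
  · obtain ⟨⟨k, rfl⟩, hk⟩ := hm
    have hk0 : 0 < k := by omega
    rw [coeff_gradedEval_of_hasSum summable_powerSum_sq.hasSum a (S := {k.toPNat hk0}),
      Finset.sum_singleton, hterm, if_pos ⟨dvd_mul_right 4 k, hk⟩, PowerSeries.coeff_C_mul,
      PowerSeries.coeff_X_pow, Nat.toPNat, PNat.mk_coe, if_pos rfl, mul_one, show 4 * k / 2 = 2 * k by omega]
    · push_cast; rfl
    · intro n hn e he
      have hn' : (n : ℕ) ≠ k := fun h => hn (Finset.mem_singleton.mpr (PNat.eq h))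
      have hd : e.degree = 4 * k := (Finset.mem_finsuppAntidiag'.mp he).1
      rw [map_smul, coeff_powerSum_sq_eq_zero (by positivity) (by omega), smul_zero]
  · rw [if_neg hm, coeff_gradedEval_of_hasSum summable_powerSum_sq.hasSum a (S := ∅),
      Finset.sum_empty]
    intro n _ e he
    have hd : e.degree = m := (Finset.mem_finsuppAntidiag'.mp he).1
    have := n.pos
    rw [map_smul, coeff_powerSum_sq_eq_zero (by positivity), smul_zero]
    rintro h
    exact hm ⟨⟨n, by omega⟩, by omega⟩

theorem gradedEval_formalLog_sub (a : ℕ → ℚ) (N : ℕ) :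
    gradedEval a N (formalLog evenSchurSum
        - ∑' n : ℕ+, (1 / (4 * (n : ℚ))) • powerSum (2 * n) ^ 2)
      = reducedLog (values a N) := by
  rw [map_sub, gradedEval_formalLog, gradedEval_tsum_powerSum_sq, reducedLog]

/-! ### Series in the odd power sums -/

/-- The weight of a monomial in `t_0, t_1, …`, where `t_k` has weight `2 k + 1`. -/
def oddWeight (e : ℕ →₀ ℕ) : ℕ := e.sum fun k m => (2 * k + 1) * m

theorem coeff_prod_C_mul_X_pow (p : ℕ → ℚ) (n : ℕ) (e : ℕ →₀ ℕ) :
    PowerSeries.coeff n (e.prod fun k m =>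
        (PowerSeries.C (p k) * PowerSeries.X ^ (2 * k + 1)) ^ m)
      = if n = oddWeight e then e.prod fun k m => p k ^ m else 0 := by
  have : (e.prod fun k m => (PowerSeries.C (p k) * PowerSeries.X ^ (2 * k + 1) : PowerSeries ℚ) ^ m)
      = PowerSeries.C (e.prod fun k m => p k ^ m) * PowerSeries.X ^ oddWeight e := by
    simp only [Finsupp.prod, oddWeight, Finsupp.sum, map_prod, mul_pow, Finset.prod_mul_distrib,
      map_pow, ← Finset.prod_pow_eq_pow_sum, pow_mul]
  rw [this, PowerSeries.coeff_C_mul, PowerSeries.coeff_X_pow, mul_ite, mul_one, mul_zero]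

theorem hasSubst_C_mul_X_pow (p : ℕ → ℚ) : MvPowerSeries.HasSubst
    fun k : ℕ => (PowerSeries.C (p k) * PowerSeries.X ^ (2 * k + 1) : PowerSeries ℚ) where
  const_coeff k := by
    have : PowerSeries.constantCoeff
        (PowerSeries.C (p k) * PowerSeries.X ^ (2 * k + 1) : PowerSeries ℚ) = 0 := by simp
    exact (show MvPowerSeries.constantCoeff
      (PowerSeries.C (p k) * PowerSeries.X ^ (2 * k + 1) : PowerSeries ℚ) = 0 from this) ▸
      IsNilpotent.zero
  coeff_zero d := by
    obtain ⟨n, rfl⟩ : ∃ n, d = Finsupp.single () n := ⟨d (), by ext; simp⟩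
    refine (Finset.range n).finite_toSet.subset fun k hk => ?_
    by_contra h
    have hn : n ≠ 2 * k + 1 := by
      simp only [Finset.coe_range, Set.mem_Iio] at h
      omega
    have h0 : PowerSeries.coeff n
        (PowerSeries.C (p k) * PowerSeries.X ^ (2 * k + 1) : PowerSeries ℚ) = 0 := by
      rw [PowerSeries.coeff_C_mul, PowerSeries.coeff_X_pow, if_neg hn, mul_zero]
    exact hk h0

/-- Among the monomials of `G`, those of weight `n` account for the whole value of `G`, if that
value is homogeneous of degree `n`. -/
theorem coeff_aeval_C_mul_X_pow {G : MvPolynomial ℕ ℚ} {n : ℕ} {p : ℕ → ℚ}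
    (h : ∀ c : ℚ, MvPolynomial.eval (fun k => c ^ (2 * k + 1) * p k) G
      = c ^ n * MvPolynomial.eval p G) :
    PowerSeries.coeff n (MvPolynomial.aeval
        (fun k => (PowerSeries.C (p k) * PowerSeries.X ^ (2 * k + 1) : PowerSeries ℚ)) G)
      = MvPolynomial.eval p G := by
  set q : Polynomial ℚ := MvPolynomial.aeval
    (fun k => Polynomial.C (p k) * Polynomial.X ^ (2 * k + 1)) G with hq
  -- Both polynomials agree at every rational `c`, since setting X = c rescales `p_k` by `c^(2k+1)`.
  have h1 : q = Polynomial.C (MvPolynomial.eval p G) * Polynomial.X ^ n := by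
    refine Polynomial.funext fun c => ?_
    rw [Polynomial.eval_mul, Polynomial.eval_C, Polynomial.eval_pow, Polynomial.eval_X, mul_comm,
      ← h c, hq, ← Polynomial.coe_aeval_eq_eval, MvPolynomial.comp_aeval_apply]
    change MvPolynomial.aeval _ G = MvPolynomial.aeval _ G
    congr 2
    funext k
    rw [Polynomial.coe_aeval_eq_eval, Polynomial.eval_mul, Polynomial.eval_C, Polynomial.eval_pow,
      Polynomial.eval_X, mul_comm]
  have h2 : MvPolynomial.aeval
      (fun k => (PowerSeries.C (p k) * PowerSeries.X ^ (2 * k + 1) : PowerSeries ℚ)) G = q := by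
    have h3 := MvPolynomial.comp_aeval_apply (σ := ℕ)
      (f := fun k => Polynomial.C (p k) * Polynomial.X ^ (2 * k + 1))
      (Polynomial.coeToPowerSeries.algHom (R := ℚ) ℚ) G
    have h4 (r : Polynomial ℚ) : Polynomial.coeToPowerSeries.algHom ℚ r = (r : PowerSeries ℚ) := by
      rw [Polynomial.coeToPowerSeries.algHom_apply, Algebra.algebraMap_self, PowerSeries.map_id]
      rfl
    rw [← h4, h3]
    congr 2
    funext k
    rw [h4, Polynomial.coe_mul, Polynomial.coe_C, Polynomial.coe_pow, Polynomial.coe_X]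
  rw [h2, h1, Polynomial.coeff_coe, Polynomial.coeff_C_mul, Polynomial.coeff_X_pow, if_pos rfl,
    mul_one]

theorem psum_values_mul_left (c : ℚ) (a : ℕ → ℚ) (N k : ℕ) :
    psum k (values (fun i => c * a i) N) = c ^ k * psum k (values a N) := by
  simp only [psum_values, mul_pow, Finset.mul_sum]

/-- The polynomials for the various degrees need not be homogeneous in weight, so the preimage
series takes from the `n`-th one only its monomials of weight `n`. The discarded monomials
contribute nothing to the value, because evaluations scale by `c^n` when all `a_i` are scaled by
`c`. -/
theorem mem_oddPowerSumSeries_of_gradedEval {f : MvPowerSeries ℕ ℚ}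
    (h : ∀ n, ∃ G : MvPolynomial ℕ ℚ, ∀ a N, PowerSeries.coeff n (gradedEval a N f)
      = MvPolynomial.eval (fun k => psum (2 * k + 1) (values a N)) G) :
    f ∈ oddPowerSumSeries := by
  choose G hG using h
  let g : MvPowerSeries ℕ ℚ := fun e => MvPolynomial.coeff e (G (oddWeight e))
  have hg : ∀ e, MvPowerSeries.coeff e g = MvPolynomial.coeff e (G (oddWeight e)) := fun _ => rfl
  refine ⟨g, ?_⟩
  rw [← sub_eq_zero]
  refine eq_zero_of_gradedEval fun a N => ?_
  rw [map_sub, sub_eq_zero]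
  set p : ℕ → ℚ := fun k => psum (2 * k + 1) (values a N) with hp
  have hsub : gradedEval a N (MvPowerSeries.subst (fun k : ℕ => powerSum (2 * k + 1)) g)
      = MvPowerSeries.subst
        (fun k => (PowerSeries.C (p k) * PowerSeries.X ^ (2 * k + 1) : PowerSeries ℚ)) g := by
    rw [gradedEval_eq_subst, MvPowerSeries.subst_comp_subst_apply hasSubst_oddPowerSum
      (hasSubst_evalVar a N)]
    congr 1
    funext k
    rw [← gradedEval_eq_subst, gradedEval_powerSum a N (by omega)]
  ext n
  -- In degree `n` the substitution sees only monomials of weight `n`, on which `g` and `G n` agree.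
  have h1 : PowerSeries.coeff n (MvPowerSeries.subst
        (fun k => (PowerSeries.C (p k) * PowerSeries.X ^ (2 * k + 1) : PowerSeries ℚ)) g)
      = PowerSeries.coeff n (MvPowerSeries.subst
        (fun k => (PowerSeries.C (p k) * PowerSeries.X ^ (2 * k + 1) : PowerSeries ℚ))
        (G n : MvPowerSeries ℕ ℚ)) := by
    have e1 := MvPowerSeries.coeff_subst (hasSubst_C_mul_X_pow p) g (Finsupp.single () n)
    have e2 := MvPowerSeries.coeff_subst (hasSubst_C_mul_X_pow p) (G n : MvPowerSeries ℕ ℚ)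
      (Finsupp.single () n)
    refine e1.trans (Eq.trans (finsum_congr fun e => ?_) e2.symm)
    have := coeff_prod_C_mul_X_pow p n e
    rw [PowerSeries.coeff] at this
    rw [this, hg, MvPolynomial.coeff_coe]
    split_ifs with hn
    · rw [hn]
    · rw [smul_zero, smul_zero]
  change PowerSeries.coeff n (gradedEval a N (MvPowerSeries.substAlgHom hasSubst_oddPowerSum g)) = _
  rw [MvPowerSeries.coe_substAlgHom, hsub, h1, MvPowerSeries.subst_coe, hG, ← hp]
  refine coeff_aeval_C_mul_X_pow fun c => ?_
  have h2 := hG n (fun i => c * a i) N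
  simp only [psum_values_mul_left] at h2
  rw [coeff_gradedEval_mul_left, hG] at h2
  exact h2.symm

end SymmFn

theorem mainTheorem12 :
    SymmFn.formalLog SymmFn.evenSchurSum
        - ∑' n : ℕ+, (1 / (4 * (n : ℚ))) • SymmFn.powerSum (2 * n) ^ 2
      ∈ SymmFn.oddPowerSumSeries := by
  refine SymmFn.mem_oddPowerSumSeries_of_gradedEval fun n => ?_
  obtain ⟨G, hG⟩ := SymmFn.exists_coeff_reducedLog_eq n
  exact ⟨G, fun a N => by rw [SymmFn.gradedEval_formalLog_sub, hG]⟩
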